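/- Let $k$ be an infinite field, $R=k[x_1,\dots,x_d]$ with the standard grading, and $I\subseteq R$ a homogeneous ideal. For $\gamma=(g_{ij})\in \mathrm{GL}_d(k)$ put $\ell_i=\sum_{j=1}^d g_{ij}x_j$. For a graded module $N$ write $\operatorname{reg}(N)=\sup\{j-p \mid \operatorname{Tor}^R_p(N,k)_j\ne 0\}$ (so $\operatorname{reg}(0)=-\infty$). "For general $\gamma$" means: for all $\gamma$ in some nonempty Zariski open subset of $\mathrm{GL}_d(k)$. (0) There are $\operatorname{sreg}_i(I)$ ($0\le i\le d$) and numbers $\alpha_{s,j}(R/I)\in\mathbb N$ ($0\le s\le d-1$, $j\ge 0$), the sectional regularities and the generic annihilator numbers of $I$, such that for general $\gamma$: the sequence $\ell_d,\dots,\ell_1$ is almost regular on $R/I$ (that is, $0:_{R/(I+(\ell_{i+1},\dots,\ell_d))}\ell_i$ is finite dimensional over $k$ for $1\le i\le d$); $\operatorname{reg}(I+(\ell_{i+1},\dots,\ell_d))=\operatorname{sreg}_i(I)$ for all $0\le i\le d$; and $\dim_k\bigl(0:_{R/(I+(\ell_{d-s+1},\dots,\ell_d))}\ell_{d-s}\bigr)_j=\alpha_{s,j}(R/I)$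 for all $0\le s\le d-1$, $j\ge 0$. Call $\alpha_{s,j}(R/I)$ coextremal if $\alpha_{s,j}(R/I)\neq 0$ and $\alpha_{s',t}(R/I)=0$ for all $(s',t)\ne(s,j)$ with $s\le s'\le d-1$ and $t\ge j$. Let $1\le i\le d$ and $j\ge 0$. (1) If $\alpha_{d-i,j}(R/I)$ is coextremal, then $\operatorname{sreg}_i(I)=j+1$. (2) If $\operatorname{sreg}_{i-1}(I)<\operatorname{sreg}_i(I)=j+1$, then $\alpha_{d-i,j}(R/I)$ is coextremal. (3) Consequently the coextremal annihilator numbers determine the jumps and the values of the sequence $\operatorname{sreg}_1(I),\dots,\operatorname{sreg}_d(I)$: for $2\le i\le d$ one has $\operatorname{sreg}_{i-1}(I)<\operatorname{sreg}_i(I)$ if and only if $\alpha_{d-i,j}(R/I)$ is coextremal for some $j$; if $I\neq 0$, then $\operatorname{sreg}_1(I)\le\cdots\le\operatorname{sreg}_d(I)$; and if $I\ne 0$ and $I\neq R$, then $$\{\operatorname{sreg}_1(I),\dots,\operatorname{sreg}_d(I)\}=\{j+1\mid \alpha_{s,j}(R/I)\text{ is coextremal for some } 0\le s\le d-1\}$$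 and, for every $1\le i\le d$, $\operatorname{sreg}_i(I)=\max\{j+1\mid \alpha_{s,j}(R/I)\text{ is coextremal for some } d-i\le s\le d-1\}$. -/

import Mathlib

open MvPolynomial

attribute [local instance] MvPolynomial.gradedAlgebra

noncomputable section

namespace SectionalRegularity

/-! ### Graded Tor through the Koszul complex, and Castelnuovo-Mumford regularity

`M` is a graded module over `R = k[x_1, …, x_d]`, with graded pieces `deg 0, deg 1, …`.
The Koszul complex `K_•(x_1, …, x_d; R)` is the graded free resolution of `k` over `R`, so that
`Tor_p^R(M, k)_j` is the degree `j` part of the `p`-th homology of `K_•(x_1, …, x_d; R) ⊗ M`. -/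

section Koszul

variable {k : Type*} [Field k] {d : ℕ} {M : Type*} [AddCommGroup M]
  [Module (MvPolynomial (Fin d) k) M] [Module k M] [IsScalarTower k (MvPolynomial (Fin d) k) M]

/-- The Koszul differential. A chain `c` stands for the sum over `S ⊆ {1, …, d}` of `e_S ⊗ c S`,
where `e_S` is the wedge of the `e_s`, `s ∈ S`, in increasing order. The basis element `e_S` goes
to the sum over `s ∈ S` of `(-1) ^ #{t ∈ S | t < s} x_s e_{S \ s}`. -/
def koszulBoundary : (Finset (Fin d) → M) →ₗ[k] (Finset (Fin d) → M) where
  toFun c T := ∑ s ∈ Tᶜ, ((-1 : ℤ) ^ (T.filter (· < s)).card) •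
    ((X s : MvPolynomial (Fin d) k) • c (insert s T))
  map_add' c c' := by
    funext T
    simp [smul_add, Finset.sum_add_distrib]
  map_smul' a c := by
    funext T
    simp only [Pi.smul_apply, RingHom.id_apply, Finset.smul_sum]
    refine Finset.sum_congr rfl fun s _ => ?_
    rw [smul_comm a, ← smul_comm a (X s : MvPolynomial (Fin d) k)]

/-- The chains of homological degree `p` and internal degree `j`: the coefficient of each `e_S`
with `#S = p` (an element of degree `p`) has degree `j - p`, the other coefficients vanish. -/
def koszulChain (deg : ℕ → Submodule k M) (p j : ℕ) : Submodule k (Finset (Fin d) → M) :=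
  Submodule.pi Set.univ fun S => if S.card = p ∧ p ≤ j then deg (j - p) else ⊥

/-- The cycles of homological degree `p` and internal degree `j`. -/
def koszulCycle (deg : ℕ → Submodule k M) (p j : ℕ) : Submodule k (Finset (Fin d) → M) :=
  koszulChain deg p j ⊓ LinearMap.ker koszulBoundary

/-- `Tor_p^R(M, k)_j`: cycles modulo boundaries. -/
abbrev gradedTor (deg : ℕ → Submodule k M) (p j : ℕ) : Type _ :=
  koszulCycle (d := d) deg p j ⧸
    ((koszulChain deg (p + 1) j).map koszulBoundary).submoduleOf (koszulCycle (d := d) deg p j)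

/-- `reg M = sup {j - p | Tor_p^R(M, k)_j ≠ 0}`; it is `⊥ = -∞` for the zero module. -/
def regularity (deg : ℕ → Submodule k M) : EReal :=
  ⨆ (p : ℕ) (j : ℕ) (_ : Nontrivial (gradedTor (d := d) deg p j)), (((j : ℝ) - (p : ℝ) : ℝ) : EReal)

end Koszul

variable {k : Type*} [Field k] {d : ℕ}

/-- The regularity of a homogeneous ideal `J`, as a graded `R`-module with
`J_n = {f ∈ J | f is homogeneous of degree n}`. -/
def idealRegularity (J : Ideal (MvPolynomial (Fin d) k)) : EReal :=
  regularity (d := d) (M := J) fun n =>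
    (homogeneousSubmodule (Fin d) k n).comap (J.subtype.restrictScalars k)

/-! ### General linear forms -/

/-- The linear form `ℓ_i = ∑_j g_{ij} x_j`. The index `i : Fin d` with value `m` stands for the
index `m + 1` of `1, …, d`. -/
def linForm (g : GL (Fin d) k) (i : Fin d) : MvPolynomial (Fin d) k :=
  ∑ j, C (g i j) * X j

/-- The ideal `I + (ℓ_{i+1}, …, ℓ_d)`, for `0 ≤ i ≤ d`. -/
def sectionIdeal (I : Ideal (MvPolynomial (Fin d) k)) (g : GL (Fin d) k) (i : ℕ) :
    Ideal (MvPolynomial (Fin d) k) :=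
  I ⊔ Ideal.span {f | ∃ t : Fin d, i ≤ (t : ℕ) ∧ f = linForm g t}

/-- The annihilator `0 :_{R/J} f`, as a `k`-subspace of `R/J`. -/
def annihilatorIn (J : Ideal (MvPolynomial (Fin d) k)) (f : MvPolynomial (Fin d) k) :
    Submodule k (MvPolynomial (Fin d) k ⧸ J) :=
  LinearMap.ker (LinearMap.mulLeft k (Ideal.Quotient.mk J f))

/-- The degree `n` part of `R/J`. -/
def quotientDegree (J : Ideal (MvPolynomial (Fin d) k)) (n : ℕ) :
    Submodule k (MvPolynomial (Fin d) k ⧸ J) :=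
  (homogeneousSubmodule (Fin d) k n).map (Ideal.Quotient.mkₐ k J).toLinearMap

/-- `ℓ_d, …, ℓ_1` is an almost regular sequence on `R/I`: for every `i` the annihilator of `ℓ_i` in
`R/(I + (ℓ_{i+1}, …, ℓ_d))` is a finite dimensional `k`-vector space. -/
def IsAlmostRegular (I : Ideal (MvPolynomial (Fin d) k)) (g : GL (Fin d) k) : Prop :=
  ∀ i : Fin d, FiniteDimensional k (annihilatorIn (sectionIdeal I g (i + 1)) (linForm g i))

/-- The annihilator number `dim_k (0 :_{M} ℓ_{d-s})_j`, where
`M = R/(I + (ℓ_{d-s+1}, …, ℓ_d))`, for `0 ≤ s ≤ d - 1`. (The linear form `ℓ_{d-s}` has the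
zero-based index `d - s - 1`, which is `s.rev`.) -/
def annihilatorNumber (I : Ideal (MvPolynomial (Fin d) k)) (g : GL (Fin d) k) (s : Fin d)
    (j : ℕ) : ℕ :=
  Module.finrank k
    (annihilatorIn (sectionIdeal I g (d - s)) (linForm g s.rev) ⊓
      quotientDegree (sectionIdeal I g (d - s)) j : Submodule k _)

/-- Zariski open subsets of `GL_d(k)`: complements of the zero loci of families of polynomials in
the matrix entries. -/
def IsZariskiOpen (U : Set (GL (Fin d) k)) : Prop :=
  ∃ S : Set (MvPolynomial (Fin d × Fin d) k),
    U = {g | ∃ F ∈ S, eval (fun e : Fin d × Fin d => g e.1 e.2) F ≠ 0}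

/-- A property holds for general `g ∈ GL_d(k)` if it holds on a nonempty Zariski open subset. -/
def ForGeneral (P : GL (Fin d) k → Prop) : Prop :=
  ∃ U : Set (GL (Fin d) k), IsZariskiOpen U ∧ U.Nonempty ∧ ∀ g ∈ U, P g

/-- The value that `f` takes on a nonempty Zariski open subset of `GL_d(k)`. -/
def genericValue {β : Type*} [Nonempty β] (f : GL (Fin d) k → β) : β :=
  Classical.epsilon fun b => ForGeneral fun g => f g = b

/-- `sreg_i(I) = reg(I + (ℓ_{i+1}, …, ℓ_d))` for general linear forms, `0 ≤ i ≤ d`. -/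
def sreg (I : Ideal (MvPolynomial (Fin d) k)) (i : ℕ) : EReal :=
  genericValue fun g => idealRegularity (sectionIdeal I g i)

/-- The generic annihilator numbers `α_{s,j}(R/I)`, `0 ≤ s ≤ d - 1`, `j ≥ 0`: the table of
annihilator numbers of `R/I` with respect to general linear forms. -/
def genericAnnihilatorNumber (I : Ideal (MvPolynomial (Fin d) k)) : Fin d → ℕ → ℕ :=
  genericValue fun g => annihilatorNumber I g

/-- `α_{s,j}(R/I)` is coextremal. -/
def IsCoextremal (I : Ideal (MvPolynomial (Fin d) k)) (s : Fin d) (j : ℕ) : Prop :=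
  genericAnnihilatorNumber I s j ≠ 0 ∧
    ∀ (s' : Fin d) (t : ℕ), (s', t) ≠ (s, j) → s ≤ s' → j ≤ t →
      genericAnnihilatorNumber I s' t = 0

end SectionalRegularity

end

/-! Let ℓ_d, …, ℓ_1 be almost regular on R/I. Cutting by one form at a time compares the Koszul
homology of R/J and R/(J+(ℓ)): reg(R/J) ≤ m holds iff 0 :_{R/J} ℓ vanishes above degree m and
reg(R/(J+(ℓ))) ≤ m (`regLE_iff`). Iterating down to the residue field (`regLE_sectionIdeal_iff`) and
using reg J = reg(R/J) + 1, the number sreg_i(I) - 1 is the last degree occupied in the rows s ≥ d -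
i of the annihilator table. So sreg_i is nondecreasing, and it jumps at i exactly when row d - i
reaches beyond all rows s > d - i; its last entry is then coextremal. The rest of (1)-(3) is
bookkeeping with maxima, provided that the maximum is taken over a nonempty set. It is for I proper
and nonzero: R/(I+(ℓ_2, …, ℓ_d)) is then a nonzero algebra of finite length, on which ℓ_1 has a
nonzero annihilator (`exists_sreg_succ_eq`).

That the invariants are generic is the harder half. Each single value of a Hilbert function of the
sections is minimal on an open set (`forGeneral_hilb_le`), but infinitely many degrees matter. One
almost regular matrix exists by prime avoidance (`exists_almostRegular`). Comparison with it shows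
that for general γ all annihilators vanish in one suitable degree, and `ColonVanish.succ` propagates
this to all larger degrees. Finitely many open conditions thus fix the whole table
(`forGeneral_colonVanish`, `forGeneral_sections`). -/

noncomputable section

namespace SectionalRegularity

variable {k : Type*} [Field k] {d : ℕ}

/-! ### The Koszul complex of the polynomial ring -/

/-- The sign of `e_s ∧ e_T`. -/
def koszulSign (T : Finset (Fin d)) (s : Fin d) : MvPolynomial (Fin d) k :=
  (-1) ^ (T.filter (· < s)).card

lemma koszulSign_mul_self (T : Finset (Fin d)) (s : Fin d) :
    koszulSign (k := k) T s * koszulSign T s = 1 := by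
  rw [koszulSign, ← mul_pow]; simp

lemma koszulSign_insert {T : Finset (Fin d)} {s : Fin d} (hs : s ∉ T) (t : Fin d) :
    koszulSign (k := k) (insert s T) t = (if s < t then -1 else 1) * koszulSign T t := by
  unfold koszulSign
  rw [Finset.filter_insert]
  split_ifs with h
  · rw [Finset.card_insert_of_notMem (by simp [hs]), pow_succ]; ring
  · simp

/-- This is e_s ∧ e_t = -e_t ∧ e_s; it cancels the terms of the double boundary in pairs. -/
lemma koszulSign_swap {T : Finset (Fin d)} {s t : Fin d} (hs : s ∉ T) (ht : t ∉ T) (h : s ≠ t) :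
    koszulSign (k := k) T s * koszulSign (insert s T) t =
      -(koszulSign T t * koszulSign (insert t T) s) := by
  rw [koszulSign_insert hs, koszulSign_insert ht]
  rcases lt_or_gt_of_ne h with h | h
  · simp [h, h.not_gt]; ring
  · simp [h, h.not_gt]; ring

lemma koszulBoundary_apply (c : Finset (Fin d) → MvPolynomial (Fin d) k) (T : Finset (Fin d)) :
    koszulBoundary (k := k) c T = ∑ s ∈ Tᶜ, koszulSign T s * (X s * c (insert s T)) := by
  simp only [koszulBoundary, koszulSign, LinearMap.coe_mk, AddHom.coe_mk, smul_eq_mul]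
  refine Finset.sum_congr rfl fun s _ => ?_
  rw [zsmul_eq_mul]; push_cast; rfl

lemma koszulBoundary_koszulBoundary (c : Finset (Fin d) → MvPolynomial (Fin d) k) :
    koszulBoundary (k := k) (koszulBoundary (k := k) c) = 0 := by
  funext T
  simp only [koszulBoundary_apply, Finset.mul_sum, Pi.zero_apply]
  rw [Finset.sum_sigma']
  refine Finset.sum_involution (fun p _ => ⟨p.2, p.1⟩) ?_ ?_ ?_ ?_
  · rintro ⟨s, t⟩ h
    simp only [Finset.mem_sigma, Finset.mem_compl, Finset.mem_insert, not_or] at h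
    have := koszulSign_swap (k := k) h.1 h.2.2 (Ne.symm h.2.1)
    rw [Finset.insert_comm t s T]
    linear_combination (X s * X t * c (insert s (insert t T))) * this
  · rintro ⟨s, t⟩ h _ h'
    simp only [Finset.mem_sigma, Finset.mem_compl, Finset.mem_insert, not_or] at h
    exact h.2.1 (congrArg Sigma.fst h')
  · rintro ⟨s, t⟩ h
    simp only [Finset.mem_sigma, Finset.mem_compl, Finset.mem_insert, not_or] at h ⊢
    exact ⟨h.2.2, Ne.symm h.2.1, h.1⟩
  · intros; rfl

/-- Exterior multiplication by `∑ a_s e_s`, a homotopy between `0` and `∑ a_s x_s`. -/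
def koszulHomotopy (a : Fin d → k) (c : Finset (Fin d) → MvPolynomial (Fin d) k) :
    Finset (Fin d) → MvPolynomial (Fin d) k :=
  fun S => ∑ s ∈ S, koszulSign (S.erase s) s * (C (a s) * c (S.erase s))

/-- The linear form with coefficients `a`. -/
def lin (a : Fin d → k) : MvPolynomial (Fin d) k := ∑ j, C (a j) * X j

/-- The boundary is an antiderivation, so wedging with ∑ a_s e_s makes multiplication by `lin a`
null-homotopic. -/
lemma koszulHomotopy_formula (a : Fin d → k) (c : Finset (Fin d) → MvPolynomial (Fin d) k) :
    koszulBoundary (k := k) (koszulHomotopy a c) + koszulHomotopy a (koszulBoundary (k := k) c) =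
      lin a • c := by
  funext T
  have h1 : koszulBoundary (k := k) (koszulHomotopy a c) T =
      ∑ s ∈ Tᶜ, (C (a s) * X s) * c T + ∑ s ∈ Tᶜ, ∑ r ∈ T,
        koszulSign T s * koszulSign ((insert s T).erase r) r * (X s * C (a r)) *
          c ((insert s T).erase r) := by
    rw [koszulBoundary_apply, ← Finset.sum_add_distrib]
    refine Finset.sum_congr rfl fun s hs => ?_
    rw [Finset.mem_compl] at hs
    rw [koszulHomotopy, Finset.sum_insert hs, Finset.erase_insert hs]
    simp only [mul_add, Finset.mul_sum]
    congr 1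
    · linear_combination (X s * C (a s) * c T) * koszulSign_mul_self (k := k) T s
    · exact Finset.sum_congr rfl fun r _ => by ring
  have h2 : koszulHomotopy a (koszulBoundary (k := k) c) T =
      ∑ s ∈ T, (C (a s) * X s) * c T + ∑ r ∈ T, ∑ s ∈ Tᶜ,
        koszulSign (T.erase r) r * koszulSign (T.erase r) s * (X s * C (a r)) *
          c ((insert s (T.erase r))) := by
    rw [koszulHomotopy, ← Finset.sum_add_distrib]
    refine Finset.sum_congr rfl fun r hr => ?_
    rw [koszulBoundary_apply, Finset.compl_erase, Finset.sum_insert (by simpa using hr),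
      Finset.insert_erase hr]
    simp only [mul_add, Finset.mul_sum]
    congr 1
    · linear_combination (X r * C (a r) * c T) * koszulSign_mul_self (k := k) (T.erase r) r
    · exact Finset.sum_congr rfl fun r _ => by ring
  rw [Pi.add_apply, h1, h2, Pi.smul_apply, smul_eq_mul, lin, Finset.sum_mul,
    ← Finset.sum_add_sum_compl T, Finset.sum_comm (s := Tᶜ)]
  -- The mixed terms, with r removed from T and s added, cancel by anticommutation. The diagonal
  -- terms over T and its complement add up to `lin a`.
  have h3 : ∑ r ∈ T, ∑ s ∈ Tᶜ, koszulSign T s * koszulSign ((insert s T).erase r) r *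
      (X s * C (a r)) * c ((insert s T).erase r) + ∑ r ∈ T, ∑ s ∈ Tᶜ,
        koszulSign (T.erase r) r * koszulSign (T.erase r) s * (X s * C (a r)) *
          c ((insert s (T.erase r))) = 0 := by
    rw [← Finset.sum_add_distrib]
    refine Finset.sum_eq_zero fun r hr => ?_
    rw [← Finset.sum_add_distrib]
    refine Finset.sum_eq_zero fun s hs => ?_
    rw [Finset.mem_compl] at hs
    have hne : s ≠ r := fun h => hs (h ▸ hr)
    rw [Finset.erase_insert_of_ne hne]
    have e1 := koszulSign_insert (k := k) (T := T.erase r) (Finset.notMem_erase r T) s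
    have e2 := koszulSign_insert (k := k) (T := T.erase r) (s := s)
      (fun h => hs (Finset.mem_of_mem_erase h)) r
    rw [Finset.insert_erase hr] at e1
    rw [e1, e2]
    rcases lt_or_gt_of_ne hne with h | h
    · simp only [h, h.not_gt, if_true, if_false]; ring
    · simp only [h, h.not_gt, if_true, if_false]; ring
  linear_combination h3

/-! ### Homogeneous chains -/

/-- `c` is a chain of homological degree `p` with homogeneous coefficients of degree `n`. -/
def IsChain (p n : ℕ) (c : Finset (Fin d) → MvPolynomial (Fin d) k) : Prop :=
  ∀ S, (c S).IsHomogeneous n ∧ (S.card ≠ p → c S = 0)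

namespace IsChain

variable {p n : ℕ} {c c' : Finset (Fin d) → MvPolynomial (Fin d) k}

lemma add (h : IsChain p n c) (h' : IsChain p n c') : IsChain p n (c + c') := fun S =>
  ⟨(h S).1.add (h' S).1, fun hS => by simp [(h S).2 hS, (h' S).2 hS]⟩

lemma sub (h : IsChain p n c) (h' : IsChain p n c') : IsChain p n (c - c') := fun S =>
  ⟨(h S).1.sub (h' S).1, fun hS => by simp [(h S).2 hS, (h' S).2 hS]⟩

lemma smul {f : MvPolynomial (Fin d) k} {m : ℕ} (h : IsChain p n c) (hf : f.IsHomogeneous m) :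
    IsChain p (m + n) (f • c) := fun S =>
  ⟨hf.mul (h S).1, fun hS => by simp [(h S).2 hS]⟩

lemma isHomogeneous_koszulSign (T : Finset (Fin d)) (s : Fin d) :
    (koszulSign (k := k) T s).IsHomogeneous 0 := by
  have : (-1 : MvPolynomial (Fin d) k).IsHomogeneous 0 := (isHomogeneous_one _ _).neg
  simpa [koszulSign] using this.pow (T.filter (· < s)).card

lemma boundary (h : IsChain (p + 1) n c) : IsChain p (n + 1) (koszulBoundary (k := k) c) := by
  intro T
  rw [koszulBoundary_apply]
  constructor
  · refine IsHomogeneous.sum _ _ _ fun s _ => ?_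
    have := (isHomogeneous_koszulSign (k := k) T s).mul
      ((isHomogeneous_X k s).mul (h (insert s T)).1)
    convert this using 1
    omega
  · intro hT
    refine Finset.sum_eq_zero fun s hs => ?_
    rw [Finset.mem_compl] at hs
    rw [(h (insert s T)).2 (by rw [Finset.card_insert_of_notMem hs]; omega)]
    simp

lemma boundary_zero (h : IsChain 0 n c) : koszulBoundary (k := k) c = 0 := by
  funext T
  rw [koszulBoundary_apply]
  refine Finset.sum_eq_zero fun s hs => ?_
  rw [(h (insert s T)).2 (by simp)]
  simp

lemma homotopy (a : Fin d → k) (h : IsChain p n c) : IsChain (p + 1) n (koszulHomotopy a c) := by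
  intro S
  constructor
  · refine IsHomogeneous.sum _ _ _ fun s _ => ?_
    have := (isHomogeneous_koszulSign (k := k) (S.erase s) s).mul
      ((isHomogeneous_C _ (a s)).mul (h (S.erase s)).1)
    convert this using 1
    omega
  · intro hS
    refine Finset.sum_eq_zero fun s hs => ?_
    have := Finset.card_erase_add_one hs
    rw [(h (S.erase s)).2 (by omega)]
    simp

lemma eq_zero_of_card_lt (h : IsChain p n c) (hp : d < p) : c = 0 := by
  funext S
  refine (h S).2 (ne_of_lt (lt_of_le_of_lt ?_ hp))
  simpa using Finset.card_le_univ S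

end IsChain

lemma koszulBoundary_smul (f : MvPolynomial (Fin d) k)
    (c : Finset (Fin d) → MvPolynomial (Fin d) k) :
    koszulBoundary (k := k) (f • c) = f • koszulBoundary (k := k) c := by
  funext T
  simp only [koszulBoundary_apply, Pi.smul_apply, smul_eq_mul, Finset.mul_sum]
  exact Finset.sum_congr rfl fun s _ => by ring

lemma koszulBoundary_mem {J : Ideal (MvPolynomial (Fin d) k)}
    {c : Finset (Fin d) → MvPolynomial (Fin d) k} (h : ∀ S, c S ∈ J) (T : Finset (Fin d)) :
    koszulBoundary (k := k) c T ∈ J := by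
  rw [koszulBoundary_apply]
  exact J.sum_mem fun s _ => J.mul_mem_left _ (J.mul_mem_left _ (h _))

lemma koszulHomotopy_mem {J : Ideal (MvPolynomial (Fin d) k)} (a : Fin d → k)
    {c : Finset (Fin d) → MvPolynomial (Fin d) k} (h : ∀ S, c S ∈ J) (T : Finset (Fin d)) :
    koszulHomotopy a c T ∈ J :=
  J.sum_mem fun _ _ => J.mul_mem_left _ (J.mul_mem_left _ (h _))

/-! ### Vanishing of Tor for subquotients of the polynomial ring -/

/-- `Tor_p(B/A, k)_{p+n+1} = 0`. -/
def TorVanish (B A : Ideal (MvPolynomial (Fin d) k)) (p n : ℕ) : Prop :=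
  ∀ c, IsChain p (n + 1) c → (∀ S, c S ∈ B) → (∀ T, koszulBoundary (k := k) c T ∈ A) →
    ∃ b, IsChain (p + 1) n b ∧ (∀ S, b S ∈ B) ∧ ∀ S, (c - koszulBoundary (k := k) b) S ∈ A

/-- `reg (R/J) ≤ m`. -/
def RegLE (J : Ideal (MvPolynomial (Fin d) k)) (m : ℕ) : Prop :=
  ∀ p n, m ≤ n → TorVanish ⊤ J p n

/-- `(0 :_{R/J} f)_n = 0`. -/
def ColonVanish (J : Ideal (MvPolynomial (Fin d) k)) (f : MvPolynomial (Fin d) k) (n : ℕ) : Prop :=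
  ∀ h : MvPolynomial (Fin d) k, h.IsHomogeneous n → f * h ∈ J → h ∈ J

lemma isHomogeneous_lin (a : Fin d → k) : (lin a).IsHomogeneous 1 :=
  IsHomogeneous.sum _ _ _ fun j _ => isHomogeneous_C_mul_X (a j) j

lemma homogeneousComponent_mul_of_left {f g : MvPolynomial (Fin d) k} {m : ℕ}
    (hf : f.IsHomogeneous m) (n : ℕ) :
    homogeneousComponent (m + n) (f * g) = f * homogeneousComponent n g := by
  conv_lhs => rw [← sum_homogeneousComponent g, Finset.mul_sum, map_sum]
  have : ∀ i ∈ Finset.range (g.totalDegree + 1),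
      homogeneousComponent (m + n) (f * homogeneousComponent i g) =
        if n = i then f * homogeneousComponent n g else 0 := fun i _ => by
    rw [homogeneousComponent_of_mem (hf.mul (homogeneousComponent_isHomogeneous i g))]
    by_cases h : n = i <;> simp [h]
  rw [Finset.sum_congr rfl this, Finset.sum_ite_eq]
  split_ifs with h
  · rfl
  · rw [homogeneousComponent_eq_zero _ _ (by simpa [Nat.lt_succ_iff] using h), mul_zero]

lemma homogeneousComponent_self {f : MvPolynomial (Fin d) k} {n : ℕ} (hf : f.IsHomogeneous n) :
    homogeneousComponent n f = f := homogeneousComponent_eq_self hf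

section

variable {J : Ideal (MvPolynomial (Fin d) k)}

lemma exists_sub_mul_mem (hJ : J.IsHomogeneous (homogeneousSubmodule (Fin d) k))
    {l f : MvPolynomial (Fin d) k} {n : ℕ} (hl : l.IsHomogeneous 1) (hf : f.IsHomogeneous (n + 1))
    (h : f ∈ J ⊔ Ideal.span {l}) : ∃ v : MvPolynomial (Fin d) k, v.IsHomogeneous n ∧
      f - l * v ∈ J := by
  obtain ⟨u, hu, w, hw, rfl⟩ := Submodule.mem_sup.1 h
  obtain ⟨w, rfl⟩ := Ideal.mem_span_singleton.1 hw
  refine ⟨homogeneousComponent n w, homogeneousComponent_isHomogeneous _ _, ?_⟩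
  have := homogeneousComponent_mem_of_mem hJ hu (n + 1)
  rw [← homogeneousComponent_self hf, map_add, add_comm n 1, homogeneousComponent_mul_of_left hl,
    add_comm 1 n]
  simpa using this

lemma IsChain.exists_sub_smul_mem (hJ : J.IsHomogeneous (homogeneousSubmodule (Fin d) k))
    {l : MvPolynomial (Fin d) k} {p n : ℕ} (hl : l.IsHomogeneous 1)
    {c : Finset (Fin d) → MvPolynomial (Fin d) k} (hc : IsChain p (n + 1) c)
    (h : ∀ S, c S ∈ J ⊔ Ideal.span {l}) :
    ∃ v : Finset (Fin d) → MvPolynomial (Fin d) k, IsChain p n v ∧ ∀ S, (c - l • v) S ∈ J := by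
  have : ∀ S, ∃ v : MvPolynomial (Fin d) k, (v.IsHomogeneous n ∧ (S.card ≠ p → v = 0)) ∧
      c S - l * v ∈ J := by
    intro S
    by_cases hS : S.card = p
    · obtain ⟨v, hv, hv'⟩ := exists_sub_mul_mem hJ hl (hc S).1 (h S)
      exact ⟨v, ⟨hv, fun h => absurd hS h⟩, hv'⟩
    · exact ⟨0, ⟨isHomogeneous_zero _ _ _, fun _ => rfl⟩, by simp [(hc S).2 hS]⟩
  choose v hv hv' using this
  exact ⟨v, hv, hv'⟩

lemma exists_sum_X_mul {f : MvPolynomial (Fin d) k} {n : ℕ} (hf : f.IsHomogeneous (n + 1)) :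
    ∃ b : Fin d → MvPolynomial (Fin d) k, (∀ s, (b s).IsHomogeneous n) ∧ f = ∑ s, X s * b s := by
  have hmem : f ∈ Ideal.span (Set.range (X : Fin d → MvPolynomial (Fin d) k)) := by
    rw [← Set.image_univ, mem_ideal_span_X_image]
    intro m hm
    by_contra! h
    have h0 : m = 0 := Finsupp.ext fun i => h i (Set.mem_univ i)
    have := hf.degree_eq_sum_deg_support hm
    simp [h0] at this
  obtain ⟨c, hc⟩ := Ideal.mem_span_range_iff_exists_fun.1 hmem
  refine ⟨fun s => homogeneousComponent n (c s),
    fun s => homogeneousComponent_isHomogeneous _ _, ?_⟩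
  rw [← homogeneousComponent_self hf, ← hc, map_sum]
  refine Finset.sum_congr rfl fun s _ => ?_
  rw [mul_comm, add_comm n 1, homogeneousComponent_mul_of_left (isHomogeneous_X k s)]

/-- The `1`-chain with coefficients `b`. -/
def oneChain (b : Fin d → MvPolynomial (Fin d) k) : Finset (Fin d) → MvPolynomial (Fin d) k :=
  fun S => ∑ s, if S = {s} then b s else 0

lemma oneChain_singleton (b : Fin d → MvPolynomial (Fin d) k) (s : Fin d) :
    oneChain b {s} = b s := by
  simp [oneChain]

lemma isChain_oneChain {b : Fin d → MvPolynomial (Fin d) k} {n : ℕ}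
    (hb : ∀ s, (b s).IsHomogeneous n) : IsChain 1 n (oneChain b) := by
  intro S
  refine ⟨IsHomogeneous.sum _ _ _ fun s _ => ?_, fun hS => Finset.sum_eq_zero fun s _ => ?_⟩
  · split_ifs
    exacts [hb s, isHomogeneous_zero _ _ _]
  · rw [if_neg]
    rintro rfl
    simp at hS

lemma isChain_single (S : Finset (Fin d)) {f : MvPolynomial (Fin d) k} {n : ℕ}
    (hf : f.IsHomogeneous n) : IsChain S.card n (Pi.single S f) := by
  intro T
  by_cases hT : T = S
  · subst hT; simpa using hf
  · simp [hT, isHomogeneous_zero]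

lemma koszulBoundary_empty (c : Finset (Fin d) → MvPolynomial (Fin d) k) :
    koszulBoundary (k := k) c ∅ = ∑ s, X s * c {s} := by
  simp [koszulBoundary_apply, koszulSign]

lemma IsChain.ext_zero {c c' : Finset (Fin d) → MvPolynomial (Fin d) k} {n : ℕ}
    (h : IsChain 0 n c) (h' : IsChain 0 n c') (h0 : c ∅ = c' ∅) : c = c' := by
  funext S
  by_cases hS : S = ∅
  · rw [hS, h0]
  · have : S.card ≠ 0 := by simpa using hS
    rw [(h S).2 this, (h' S).2 this]

/-- `Tor_0(J, k)_{n+1} = 0` says that `J` has no generators in degree `n + 1`. -/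
lemma torVanish_zero_iff (J : Ideal (MvPolynomial (Fin d) k)) (n : ℕ) :
    TorVanish J ⊥ 0 n ↔ ∀ f ∈ J, f.IsHomogeneous (n + 1) →
      ∃ b : Fin d → MvPolynomial (Fin d) k, (∀ s, (b s).IsHomogeneous n ∧ b s ∈ J) ∧
        f = ∑ s, X s * b s := by
  constructor
  · intro h f hfJ hf
    have hc : IsChain 0 (n + 1) (Pi.single ∅ f) := isChain_single ∅ hf
    have hcJ : ∀ S, Pi.single (M := fun _ => MvPolynomial (Fin d) k) (∅ : Finset (Fin d)) f S ∈ J :=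
      fun S => by
        by_cases hS : S = ∅
        · subst hS; simpa using hfJ
        · simp [hS]
    obtain ⟨b, hb, hbJ, hb'⟩ := h _ hc hcJ fun T => by simp [hc.boundary_zero]
    refine ⟨fun s => b {s}, fun s => ⟨(hb _).1, hbJ _⟩, ?_⟩
    have := hb' ∅
    rw [Pi.sub_apply, koszulBoundary_empty] at this
    simpa [sub_eq_zero] using this
  · intro h c hc hcJ _
    obtain ⟨b, hb, hb'⟩ := h (c ∅) (hcJ ∅) (hc ∅).1
    have hch := isChain_oneChain fun s => (hb s).1
    refine ⟨oneChain b, hch, fun S => J.sum_mem fun s _ => ?_, fun S => ?_⟩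
    · split_ifs
      exacts [(hb s).2, J.zero_mem]
    · have := IsChain.ext_zero hc hch.boundary
        (by simp [koszulBoundary_empty, oneChain_singleton, hb'])
      rw [← this]; simp

/-- R/J is generated by 1, so its Tor_0 lives in degree 0 only. -/
lemma TorVanish.top_zero (J : Ideal (MvPolynomial (Fin d) k)) (n : ℕ) : TorVanish ⊤ J 0 n := by
  intro c hc hcJ _
  have h : TorVanish (⊤ : Ideal (MvPolynomial (Fin d) k)) ⊥ 0 n := by
    rw [torVanish_zero_iff]
    intro f _ hf
    obtain ⟨b, hb, hb'⟩ := exists_sum_X_mul hf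
    exact ⟨b, fun s => ⟨hb s, trivial⟩, hb'⟩
  obtain ⟨b, hb, hb', hb''⟩ := h c hc hcJ fun T => by simp [hc.boundary_zero]
  exact ⟨b, hb, hb', fun S => (bot_le : ⊥ ≤ J) (hb'' S)⟩

lemma IsChain.isHomogeneous_boundary {p n : ℕ} {c : Finset (Fin d) → MvPolynomial (Fin d) k}
    (h : IsChain p n c) (T : Finset (Fin d)) :
    (koszulBoundary (k := k) c T).IsHomogeneous (n + 1) := by
  cases p with
  | zero => simp [h.boundary_zero, isHomogeneous_zero]
  | succ p => exact (h.boundary T).1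

/-- Write ℓ = `lin a`. A cycle c is ∂b + ℓv modulo J. Then ℓ∂v lies in J, so v is a cycle modulo J
by `hcol`, and the homotopy turns ℓv into a boundary. -/
lemma TorVanish.of_sup (hJ : J.IsHomogeneous (homogeneousSubmodule (Fin d) k)) (a : Fin d → k)
    {p n : ℕ} (h : TorVanish ⊤ (J ⊔ Ideal.span {lin a}) p n)
    (hcol : ColonVanish J (lin a) (n + 1)) : TorVanish ⊤ J p n := by
  intro c hc hcT hcJ
  obtain ⟨b, hb, -, hb'⟩ := h c hc hcT fun T => (le_sup_left : J ≤ _) (hcJ T)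
  obtain ⟨v, hv, hv'⟩ := (hc.sub hb.boundary).exists_sub_smul_mem hJ (isHomogeneous_lin a) hb'
  have hdv : ∀ T, koszulBoundary (k := k) v T ∈ J := fun T => by
    refine hcol _ (hv.isHomogeneous_boundary T) ?_
    have h1 := koszulBoundary_mem hv' T
    rw [map_sub, map_sub, koszulBoundary_koszulBoundary, koszulBoundary_smul] at h1
    have h2 := J.sub_mem (hcJ T) h1
    simpa using h2
  refine ⟨b + koszulHomotopy a v, hb.add (hv.homotopy a), fun _ => trivial, fun S => ?_⟩
  have h1 := congrFun (koszulHomotopy_formula a v) S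
  have h2 := J.add_mem (hv' S) (koszulHomotopy_mem a hdv S)
  convert h2 using 1
  simp only [Pi.add_apply, Pi.sub_apply, map_add] at h1 ⊢
  linear_combination -h1

/-- An annihilated f whose multiples x_s f all vanish is a socle element of R/J, that is, a cycle in
the top Koszul degree d. There are no (d+1)-chains to bound it, so f lies in J. -/
lemma ColonVanish.of_succ (a : Fin d → k) {n : ℕ} (h : TorVanish ⊤ J d n)
    (hcol : ColonVanish J (lin a) (n + 2)) : ColonVanish J (lin a) (n + 1) := by
  intro f hf hfJ
  have hX : ∀ s, X s * f ∈ J := fun s => by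
    refine hcol _ ?_ ?_
    · have := (isHomogeneous_X k s).mul hf
      convert this using 1; omega
    · have := J.mul_mem_left (X s) hfJ
      convert this using 1; ring
  have hc := isChain_single Finset.univ hf
  rw [Finset.card_univ, Fintype.card_fin] at hc
  have hcJ : ∀ T, koszulBoundary (k := k) (Pi.single (Finset.univ : Finset (Fin d)) f) T ∈ J :=
    fun T => by
      rw [koszulBoundary_apply]
      refine J.sum_mem fun s _ => J.mul_mem_left _ ?_
      by_cases hS : insert s T = Finset.univ
      · rw [hS]; simpa using hX s
      · simp [hS]
  obtain ⟨b, hb, -, hb'⟩ := h _ hc (fun _ => trivial) hcJ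
  have := hb' Finset.univ
  rw [hb.eq_zero_of_card_lt (by omega)] at this
  simpa using this

/-- For a cycle c modulo J + (ℓ), write ∂c = ℓv modulo J. Then v is a cycle modulo J, hence ∂w, and
c - ℓw is a cycle modulo J. For p = 0 the 0-chain v is a cycle for free, so nothing is asked of ℓ.
-/
lemma TorVanish.sup (hJ : J.IsHomogeneous (homogeneousSubmodule (Fin d) k)) (a : Fin d → k)
    {p n : ℕ} (h : TorVanish ⊤ J (p + 1) n) (h' : TorVanish ⊤ J p n)
    (hcol : p ≠ 0 → ColonVanish J (lin a) (n + 2)) :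
    TorVanish ⊤ (J ⊔ Ideal.span {lin a}) (p + 1) n := by
  intro c hc hcT hcJ
  obtain ⟨v, hv, hv'⟩ := hc.boundary.exists_sub_smul_mem hJ (isHomogeneous_lin a) hcJ
  have hdv : ∀ T, koszulBoundary (k := k) v T ∈ J := fun T => by
    by_cases hp : p = 0
    · subst hp; simp [hv.boundary_zero]
    refine hcol hp _ (hv.isHomogeneous_boundary T) ?_
    have h1 := koszulBoundary_mem hv' T
    rw [map_sub, koszulBoundary_koszulBoundary, koszulBoundary_smul] at h1
    simpa using h1
  obtain ⟨w, hw, -, hw'⟩ := h' v hv (fun _ => trivial) hdv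
  have hlw : IsChain (p + 1) (n + 1) (lin a • w) := by
    rw [add_comm n 1]; exact hw.smul (isHomogeneous_lin a)
  obtain ⟨b, hb, -, hb'⟩ := h (c - lin a • w) (hc.sub hlw) (fun _ => trivial) fun T => by
    have := J.add_mem (hv' T) (J.mul_mem_left (lin a) (hw' T))
    rw [map_sub, koszulBoundary_smul]
    convert this using 1
    simp only [Pi.sub_apply, Pi.smul_apply, smul_eq_mul]
    ring
  refine ⟨b, hb, fun _ => trivial, fun S => ?_⟩
  have h1 := (le_sup_left : J ≤ J ⊔ Ideal.span {lin a}) (hb' S)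
  have h2 := (le_sup_right : Ideal.span {lin a} ≤ J ⊔ Ideal.span {lin a})
    (Ideal.mul_mem_right (w S) _ (Ideal.mem_span_singleton_self (lin a)))
  convert Ideal.add_mem _ h1 h2 using 1
  simp only [Pi.sub_apply, Pi.smul_apply, smul_eq_mul]
  ring

/-- The criterion for almost regular sequences to compute the regularity. -/
theorem regLE_iff (hJ : J.IsHomogeneous (homogeneousSubmodule (Fin d) k)) (a : Fin d → k)
    {N : ℕ} (hN : ∀ n, N ≤ n → ColonVanish J (lin a) n) (m : ℕ) :
    RegLE J m ↔ (∀ n, m < n → ColonVanish J (lin a) n) ∧ RegLE (J ⊔ Ideal.span {lin a}) m := by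
  constructor
  · intro h
    have hcol : ∀ n, m < n → ColonVanish J (lin a) n := by
      intro n hn
      by_cases hnN : N ≤ n
      · exact hN n hnN
      -- Almost regularity gives vanishing from N on; the socle argument carries it down to degree m
      -- + 1.
      refine Nat.decreasingInduction' (n := N) (P := ColonVanish J (lin a)) (fun j _ hj ih => ?_)
        (not_le.1 hnN).le (hN N le_rfl)
      obtain ⟨j, rfl⟩ := Nat.exists_eq_succ_of_ne_zero (n := j) (by omega)
      exact ColonVanish.of_succ a (h d j (by omega)) ih
    refine ⟨hcol, fun p n hn => ?_⟩
    cases p with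
    | zero => exact TorVanish.top_zero _ _
    | succ p => exact TorVanish.sup hJ a (h _ _ hn) (h _ _ hn) fun _ => hcol _ (by omega)
  · rintro ⟨h1, h2⟩ p n hn
    exact TorVanish.of_sup hJ a (h2 p n hn) (h1 _ (by omega))

/-- Persistence of the vanishing of annihilators. -/
lemma ColonVanish.succ (hJ : J.IsHomogeneous (homogeneousSubmodule (Fin d) k)) (a : Fin d → k)
    {n : ℕ} (h1 : TorVanish ⊤ J 1 (n + 1)) (h2 : TorVanish ⊤ (J ⊔ Ideal.span {lin a}) 2 n)
    (hcol : ColonVanish J (lin a) (n + 1)) : ColonVanish J (lin a) (n + 2) := by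
  intro f hf hfJ
  -- Write f = ∂v. As ℓf lies in J, ℓv is a 1-cycle modulo J, hence ∂b. Then b is a 2-cycle modulo J
  -- + (ℓ), so b = ∂b₁ + ℓw modulo J. Now ℓ(v - ∂w) lies in J in degree n + 2, so `hcol` puts v - ∂w
  -- in J, and with it f = ∂v.
  obtain ⟨v₀, hv₀, hfv⟩ := exists_sum_X_mul (n := n + 1) hf
  have hv := isChain_oneChain hv₀
  set v := oneChain v₀ with hvdef
  have hdv : koszulBoundary (k := k) v = Pi.single ∅ f := by
    refine IsChain.ext_zero hv.boundary (n := n + 2) (isChain_single ∅ hf) ?_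
    simp [koszulBoundary_empty, hvdef, oneChain_singleton, ← hfv]
  have hlv : IsChain 1 (n + 1 + 1) (lin a • v) := by
    rw [add_comm (n + 1) 1]; exact hv.smul (isHomogeneous_lin a)
  obtain ⟨b, hb, -, hb'⟩ := h1 (lin a • v) hlv (fun _ => trivial) fun T => by
    rw [koszulBoundary_smul, hdv]
    by_cases hT : T = ∅
    · subst hT; simpa using hfJ
    · simp [hT]
  obtain ⟨b₁, hb₁, -, hb₁'⟩ := h2 b hb (fun _ => trivial) fun T => by
    have e1 := (le_sup_left : J ≤ J ⊔ Ideal.span {lin a}) (hb' T)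
    have e2 := (le_sup_right : Ideal.span {lin a} ≤ J ⊔ Ideal.span {lin a})
      (Ideal.mul_mem_right (v T) _ (Ideal.mem_span_singleton_self (lin a)))
    have e3 := Ideal.sub_mem _ e2 e1
    simpa using e3
  obtain ⟨w, hw, hw'⟩ := (hb.sub hb₁.boundary).exists_sub_smul_mem hJ (isHomogeneous_lin a) hb₁'
  have hvw : ∀ S, (v - koszulBoundary (k := k) w) S ∈ J := fun S => by
    refine hcol _ ((hv.sub hw.boundary) S).1 ?_
    have e1 := koszulBoundary_mem hw' S
    rw [map_sub, map_sub, koszulBoundary_koszulBoundary, koszulBoundary_smul] at e1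
    have e2 := J.add_mem (hb' S) e1
    convert e2 using 1
    simp only [Pi.sub_apply, Pi.smul_apply, smul_eq_mul, Pi.zero_apply]
    ring
  have := koszulBoundary_mem hvw ∅
  rw [map_sub, koszulBoundary_koszulBoundary, hdv] at this
  simpa using this

end

/-! ### The polynomial ring and the maximal ideal -/

/-- `RegLE` only sees chains with coefficients of positive degree, and these lie in J. -/
lemma regLE_of_X_mem {J : Ideal (MvPolynomial (Fin d) k)} (hJ : ∀ s, X s ∈ J) (m : ℕ) :
    RegLE J m := by
  intro p n _ c hc _ _
  refine ⟨0, fun S => ⟨isHomogeneous_zero _ _ _, fun _ => rfl⟩, fun _ => trivial, fun S => ?_⟩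
  obtain ⟨b, -, hb⟩ := exists_sum_X_mul (hc S).1
  simp only [map_zero, sub_zero]
  rw [hb]
  exact J.sum_mem fun s _ => J.mul_mem_right _ (hJ s)

lemma isHomogeneous_span_X (s : Set (Fin d)) :
    (Ideal.span (X '' s : Set (MvPolynomial (Fin d) k))).IsHomogeneous
      (homogeneousSubmodule (Fin d) k) := by
  refine Ideal.homogeneous_span _ _ ?_
  rintro _ ⟨i, -, rfl⟩
  exact ⟨1, isHomogeneous_X k i⟩

lemma lin_single (i : Fin d) : lin (Pi.single i (1 : k)) = X i := by
  rw [lin, Finset.sum_eq_single i] <;> simp +contextual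

/-- Acyclicity of the Koszul complex. The variables are removed from the irrelevant ideal one at a
time; each is a nonzerodivisor modulo the later ones, so `regLE_iff` applies with no annihilators.
-/
lemma regLE_bot : RegLE (⊥ : Ideal (MvPolynomial (Fin d) k)) 0 := by
  have key : ∀ i, i ≤ d →
      RegLE (Ideal.span (X '' {t : Fin d | i ≤ t} : Set (MvPolynomial (Fin d) k))) 0 := by
    intro i
    induction i with
    | zero =>
      intro _
      exact regLE_of_X_mem (fun s => Ideal.subset_span (Set.mem_image_of_mem _ (Nat.zero_le _))) 0
    | succ i ih =>
      intro hi
      have hcol : ∀ n, ColonVanish (Ideal.span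
          (X '' {t : Fin d | i + 1 ≤ t} : Set (MvPolynomial (Fin d) k)))
          (lin (Pi.single ⟨i, hi⟩ (1 : k))) n := by
        intro n f _ hf
        rw [lin_single, mem_ideal_span_X_image] at hf
        rw [mem_ideal_span_X_image]
        intro m hm
        obtain ⟨t, ht, ht'⟩ := hf (Finsupp.single ⟨i, hi⟩ 1 + m) (by
          rw [mem_support_iff, coeff_X_mul]; exact mem_support_iff.1 hm)
        refine ⟨t, ht, ?_⟩
        have : (⟨i, hi⟩ : Fin d) ≠ t := by
          rintro rfl
          simp at ht
        simpa [Finsupp.single_apply, this] using ht'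
      refine (regLE_iff (isHomogeneous_span_X _) _ (N := 0) (fun n _ => hcol n) 0).2
        ⟨fun n _ => hcol n, ?_⟩
      convert ih (by omega) using 1
      rw [lin_single, ← Ideal.span_union, ← Set.image_singleton, ← Set.image_union]
      congr 2
      ext t
      simp only [Set.mem_union, Set.mem_ofPred_eq, Set.mem_singleton_iff, Fin.ext_iff]
      omega
  have h := key d le_rfl
  have : {t : Fin d | d ≤ (t : ℕ)} = ∅ := by
    ext t; simp
  simpa [this] using h

/-- `reg J ≤ m + 1` if and only if `reg (R/J) ≤ m`. -/
lemma regLE_iff_forall_torVanish (J : Ideal (MvPolynomial (Fin d) k)) (m : ℕ) :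
    RegLE J m ↔ ∀ p n, m + 1 ≤ n → TorVanish J ⊥ p n := by
  constructor
  · intro h p n hn c hc hcJ hcb
    obtain ⟨n, rfl⟩ := Nat.exists_eq_succ_of_ne_zero (n := n) (by omega)
    -- The connecting isomorphism Tor_{p+1}(R/J) ≅ Tor_p(J): by acyclicity c = ∂a, and a is a cycle
    -- modulo J.
    obtain ⟨a, ha, -, ha'⟩ := regLE_bot p (n + 1) (Nat.zero_le _) c hc (fun _ => trivial) hcb
    have hca : c = koszulBoundary (k := k) a := by
      funext S; simpa [sub_eq_zero] using ha' S
    obtain ⟨b, hb, -, hb'⟩ := h (p + 1) n (by omega) a ha (fun _ => trivial) fun T => by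
      rw [← hca]; exact hcJ T
    refine ⟨a - koszulBoundary (k := k) b, ha.sub hb.boundary, hb', fun S => ?_⟩
    rw [map_sub, koszulBoundary_koszulBoundary, hca]
    simp
  · intro h p n hn
    cases p with
    | zero => exact TorVanish.top_zero _ _
    | succ p =>
      intro c hc _ hcJ
      obtain ⟨b, hb, hbJ, hb'⟩ := h p (n + 1) (by omega) (koszulBoundary (k := k) c)
        hc.boundary hcJ fun T => by simp [koszulBoundary_koszulBoundary]
      obtain ⟨b', hb₁, -, hb₂⟩ := regLE_bot (p + 1) n (Nat.zero_le _) (c - b) (hc.sub hb)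
        (fun _ => trivial) fun T => by rw [map_sub]; exact hb' T
      refine ⟨b', hb₁, fun _ => trivial, fun S => ?_⟩
      have h1 : (c - b - koszulBoundary (k := k) b') S = 0 := by simpa using hb₂ S
      convert hbJ S using 1
      simp only [Pi.sub_apply] at h1 ⊢
      linear_combination h1

/-! ### The regularity of an ideal -/

section

variable (J : Ideal (MvPolynomial (Fin d) k))

/-- The grading of an ideal. -/
abbrev idealDegree (n : ℕ) : Submodule k J :=
  (homogeneousSubmodule (Fin d) k n).comap (J.subtype.restrictScalars k)

lemma coe_koszulBoundary (c : Finset (Fin d) → J) (T : Finset (Fin d)) :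
    ((koszulBoundary (k := k) c T : J) : MvPolynomial (Fin d) k) =
      koszulBoundary (k := k) (fun S => (c S : MvPolynomial (Fin d) k)) T := by
  simp [koszulBoundary]

lemma mem_koszulChain_iff (p n : ℕ) (c : Finset (Fin d) → J) :
    c ∈ koszulChain (idealDegree J) p (p + n) ↔
      IsChain p n fun S => (c S : MvPolynomial (Fin d) k) := by
  rw [koszulChain, Submodule.mem_pi]
  refine ⟨fun h S => ?_, fun h S _ => ?_⟩
  · have := h S trivial
    by_cases hS : S.card = p
    · rw [if_pos ⟨hS, by omega⟩, Nat.add_sub_cancel_left] at this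
      exact ⟨this, fun h => absurd hS h⟩
    · rw [if_neg (by tauto), Submodule.mem_bot] at this
      simp [this, isHomogeneous_zero]
  · by_cases hS : S.card = p
    · rw [if_pos ⟨hS, by omega⟩, Nat.add_sub_cancel_left]
      exact (h S).1
    · rw [if_neg (by tauto), Submodule.mem_bot]
      exact Subtype.ext ((h S).2 hS)

/-- Internal degree p + (n + 1) means coefficients of degree n + 1. The case of coefficient degree 0
is not covered by `TorVanish`; it matters only for the unit ideal. -/
lemma nontrivial_gradedTor_iff (p n : ℕ) :
    Nontrivial (gradedTor (d := d) (idealDegree J) p (p + (n + 1))) ↔ ¬ TorVanish J ⊥ p n := by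
  refine Submodule.Quotient.nontrivial_iff.trans ?_
  rw [Ne, Submodule.submoduleOf, Submodule.comap_subtype_eq_top, not_iff_not]
  constructor
  · intro h c hc hcJ hcb
    let c' : Finset (Fin d) → J := fun S => ⟨c S, hcJ S⟩
    have hc' : c' ∈ koszulCycle (idealDegree J) p (p + (n + 1)) := by
      refine ⟨(mem_koszulChain_iff J p (n + 1) c').2 hc, ?_⟩
      refine LinearMap.mem_ker.2 (funext fun T => ?_)
      refine Subtype.ext ?_
      rw [coe_koszulBoundary]
      simpa using hcb T
    obtain ⟨b, hb, hbc⟩ := h hc'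
    rw [show p + (n + 1) = p + 1 + n by omega] at hb
    refine ⟨fun S => b S, (mem_koszulChain_iff J (p + 1) n b).1 hb, fun S => (b S).2, fun S => ?_⟩
    have h1 := congrArg Subtype.val (congrFun hbc S)
    rw [coe_koszulBoundary] at h1
    rw [Pi.sub_apply, h1]
    simp [c']
  · rintro h c ⟨hc, hcb⟩
    obtain ⟨b, hb, hbJ, hb'⟩ := h _ ((mem_koszulChain_iff J p (n + 1) c).1 hc) (fun S => (c S).2)
      fun T => by
        rw [← coe_koszulBoundary, LinearMap.mem_ker.1 hcb]; simp
    refine ⟨fun S => ⟨b S, hbJ S⟩, ?_, ?_⟩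
    · rw [show p + (n + 1) = p + 1 + n by omega]
      exact (mem_koszulChain_iff J (p + 1) n _).2 hb
    · funext S
      refine Subtype.ext ?_
      rw [coe_koszulBoundary]
      exact (sub_eq_zero.1 (by simpa using hb' S)).symm

lemma idealRegularity_eq_iSup : idealRegularity J =
    ⨆ (p : ℕ) (j : ℕ) (_ : Nontrivial (gradedTor (d := d) (idealDegree J) p j)),
      (((j : ℝ) - (p : ℝ) : ℝ) : EReal) := rfl

lemma idealRegularity_le {m : ℕ} (h : ∀ p n, m ≤ n → TorVanish J ⊥ p n) :
    idealRegularity J ≤ (m : EReal) := by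
  rw [idealRegularity_eq_iSup]
  refine iSup_le fun p => iSup_le fun j => iSup_le fun hj => ?_
  have : j ≤ p + m := by
    by_contra! hlt
    obtain ⟨n, rfl⟩ := Nat.exists_eq_add_of_lt (show p < j by omega)
    exact (nontrivial_gradedTor_iff J p n).1 hj (h p n (by omega))
  have h2 : (j : ℝ) ≤ p + m := by exact_mod_cast this
  have h3 : (j : ℝ) - p ≤ m := by linarith
  exact_mod_cast h3

lemma le_idealRegularity {p n : ℕ} (h : ¬ TorVanish J ⊥ p n) :
    (n : EReal) + 1 ≤ idealRegularity J := by
  rw [idealRegularity_eq_iSup]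
  refine le_trans (le_of_eq ?_) (le_iSup_of_le p (le_iSup_of_le (p + (n + 1))
    (le_iSup_of_le ((nontrivial_gradedTor_iff J p n).2 h) le_rfl)))
  have : ((p + (n + 1) : ℕ) : ℝ) - (p : ℝ) = n + 1 := by push_cast; ring
  rw [this]
  rfl

variable {J}

/-- Graded Nakayama: there are no generators in positive degrees, and none in degree 0 as J is
proper. -/
lemma eq_bot_of_forall_torVanish (hJ : J.IsHomogeneous (homogeneousSubmodule (Fin d) k))
    (hJt : J ≠ ⊤) (h : ∀ n, TorVanish J ⊥ 0 n) : J = ⊥ := by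
  have key : ∀ n, ∀ f ∈ J, f.IsHomogeneous n → f = 0 := by
    intro n
    induction n with
    | zero =>
      intro f hf hf0
      rw [← homogeneousComponent_self hf0, homogeneousComponent_zero] at hf ⊢
      by_contra hne
      refine hJt (Ideal.eq_top_of_isUnit_mem _ hf ?_)
      exact (isUnit_iff_ne_zero.2 fun h0 => hne (by rw [h0, C_0])).map C
    | succ n ih =>
      intro f hf hf0
      obtain ⟨b, hb, rfl⟩ := (torVanish_zero_iff J n).1 (h n) f hf hf0
      exact Finset.sum_eq_zero fun s _ => by rw [ih _ (hb s).2 (hb s).1, mul_zero]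
  rw [eq_bot_iff]
  intro f hf
  rw [Submodule.mem_bot, ← sum_homogeneousComponent f]
  exact Finset.sum_eq_zero fun n _ => key n _ (homogeneousComponent_mem_of_mem hJ hf n)
    (homogeneousComponent_isHomogeneous n f)

theorem idealRegularity_eq (hJ : J.IsHomogeneous (homogeneousSubmodule (Fin d) k))
    (hJb : J ≠ ⊥) (hJt : J ≠ ⊤) {m : ℕ} (h : RegLE J m) (h' : ∀ m' < m, ¬ RegLE J m') :
    idealRegularity J = (m : EReal) + 1 := by
  refine le_antisymm ?_ ?_
  · have := idealRegularity_le J ((regLE_iff_forall_torVanish J m).1 h)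
    exact_mod_cast this
  · cases m with
    | zero =>
      -- Here no smaller m' is available; instead a nonzero proper ideal has a generator of positive
      -- degree, so its regularity is at least 1.
      by_contra hlt
      refine hJb (eq_bot_of_forall_torVanish hJ hJt fun n => ?_)
      by_contra hn
      refine hlt (le_trans ?_ (le_idealRegularity J hn))
      have : ((0 : ℕ) : EReal) ≤ (n : EReal) := by exact_mod_cast Nat.zero_le n
      gcongr
    | succ m =>
      have := h' m (Nat.lt_succ_self m)
      rw [regLE_iff_forall_torVanish] at this
      push Not at this
      obtain ⟨p, n, hn, hpn⟩ := this
      refine le_trans ?_ (le_idealRegularity J hpn)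
      have : ((m + 1 : ℕ) : EReal) ≤ (n : EReal) := by exact_mod_cast hn
      gcongr

end

lemma idealRegularity_bot : idealRegularity (⊥ : Ideal (MvPolynomial (Fin d) k)) = ⊥ := by
  rw [idealRegularity_eq_iSup]
  refine le_bot_iff.1 (iSup_le fun p => iSup_le fun j => iSup_le fun hj => ?_)
  have hs : Subsingleton (koszulCycle (d := d)
      (idealDegree (⊥ : Ideal (MvPolynomial (Fin d) k))) p j) := inferInstance
  exact absurd hj (not_nontrivial_iff_subsingleton.2 (Submodule.mkQ_surjective _).subsingleton)

lemma idealRegularity_top : idealRegularity (⊤ : Ideal (MvPolynomial (Fin d) k)) = 0 := by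
  refine le_antisymm ?_ ?_
  · have := idealRegularity_le (⊤ : Ideal (MvPolynomial (Fin d) k)) (m := 0)
      fun p n _ => regLE_bot p n (Nat.zero_le n)
    exact_mod_cast this
  · rw [idealRegularity_eq_iSup]
    have hnt : Nontrivial (gradedTor (d := d)
        (idealDegree (⊤ : Ideal (MvPolynomial (Fin d) k))) 0 (0 + 0)) := by
      refine Submodule.Quotient.nontrivial_iff.2 ?_
      rw [Ne, Submodule.submoduleOf, Submodule.comap_subtype_eq_top]
      intro h
      let c : Finset (Fin d) → (⊤ : Ideal (MvPolynomial (Fin d) k)) := fun S =>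
        ⟨Pi.single (M := fun _ => MvPolynomial (Fin d) k) ∅ 1 S, trivial⟩
      have hc : IsChain 0 0 fun S => (c S : MvPolynomial (Fin d) k) :=
        isChain_single ∅ (isHomogeneous_one _ _)
      obtain ⟨b, hb, hbc⟩ := h (x := c) ⟨(mem_koszulChain_iff _ 0 0 c).2 hc, by
        refine LinearMap.mem_ker.2 (funext fun T => ?_)
        refine Subtype.ext ?_
        rw [coe_koszulBoundary, hc.boundary_zero]
        rfl⟩
      -- A 1-chain of internal degree 0 would need coefficients of degree -1, so the class of 1 is
      -- not a boundary.
      have hb0 : b = 0 := by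
        funext S
        have := (Submodule.mem_pi.1 hb) S trivial
        rw [if_neg (by omega)] at this
        exact this
      have := congrArg Subtype.val (congrFun hbc ∅)
      rw [hb0] at this
      simp [c] at this
    refine le_iSup_of_le 0 (le_iSup_of_le (0 + 0) (le_iSup_of_le hnt (le_of_eq ?_)))
    simp

/-! ### Hilbert functions -/

lemma finrank_map_add_finrank_ker_inf {V W : Type*} [AddCommGroup V] [Module k V] [AddCommGroup W]
    [Module k W] (L : V →ₗ[k] W) (p : Submodule k V) [FiniteDimensional k p] :
    Module.finrank k (p.map L) + Module.finrank k (LinearMap.ker L ⊓ p : Submodule k V) =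
      Module.finrank k p := by
  rw [← LinearMap.finrank_range_add_finrank_ker (L.domRestrict p), LinearMap.range_domRestrict,
    LinearMap.ker_domRestrict]
  congr 1
  have : (LinearMap.ker L).comap p.subtype = (LinearMap.ker L ⊓ p).comap p.subtype := by
    ext; simp
  rw [this]
  exact (Submodule.comapSubtypeEquivOfLe inf_le_right).finrank_eq.symm

instance (n : ℕ) : FiniteDimensional k (homogeneousSubmodule (Fin d) k n) :=
  Module.Finite.iff_fg.2 (homogeneousSubmodule_fg (Fin d) k n)

instance (J : Ideal (MvPolynomial (Fin d) k)) (n : ℕ) : FiniteDimensional k (quotientDegree J n) :=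
  Module.Finite.map _ _

/-- The Hilbert function of `R/J`. -/
def hilb (J : Ideal (MvPolynomial (Fin d) k)) (n : ℕ) : ℕ := Module.finrank k (quotientDegree J n)

/-- The degree `n` part of an ideal. -/
def degreePart (J : Ideal (MvPolynomial (Fin d) k)) (n : ℕ) :
    Submodule k (MvPolynomial (Fin d) k) :=
  J.restrictScalars k ⊓ homogeneousSubmodule (Fin d) k n

instance (J : Ideal (MvPolynomial (Fin d) k)) (n : ℕ) : FiniteDimensional k (degreePart J n) :=
  Submodule.finiteDimensional_of_le inf_le_right

lemma hilb_add_finrank_degreePart (J : Ideal (MvPolynomial (Fin d) k)) (n : ℕ) :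
    hilb J n + Module.finrank k (degreePart J n) =
      Module.finrank k (homogeneousSubmodule (Fin d) k n) := by
  have : degreePart J n = LinearMap.ker (Ideal.Quotient.mkₐ k J).toLinearMap ⊓
      homogeneousSubmodule (Fin d) k n := by
    ext f
    simp [degreePart, Ideal.Quotient.eq_zero_iff_mem]
  rw [this]
  exact finrank_map_add_finrank_ker_inf (Ideal.Quotient.mkₐ k J).toLinearMap _

/-- Dimension count in 0 → (0 : ℓ)_n → (R/J)_n → (R/J)_{n+1} → (R/(J+(ℓ)))_{n+1} → 0. -/
lemma hilb_add_hilb_sup {J : Ideal (MvPolynomial (Fin d) k)}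
    (hJ : J.IsHomogeneous (homogeneousSubmodule (Fin d) k)) (a : Fin d → k) (n : ℕ) :
    hilb J n + hilb (J ⊔ Ideal.span {lin a}) (n + 1) =
      Module.finrank k (annihilatorIn J (lin a) ⊓ quotientDegree J n : Submodule k _) +
        hilb J (n + 1) := by
  have h1 := finrank_map_add_finrank_ker_inf
    (LinearMap.mulLeft k (Ideal.Quotient.mk J (lin a))) (quotientDegree J n)
  let π := (Ideal.Quotient.factorₐ k
    (le_sup_left : J ≤ J ⊔ Ideal.span {lin a})).toLinearMap
  have h2 := finrank_map_add_finrank_ker_inf π (quotientDegree J (n + 1))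
  have e1 : (quotientDegree J (n + 1)).map π =
      quotientDegree (J ⊔ Ideal.span {lin a}) (n + 1) := by
    rw [quotientDegree, ← Submodule.map_comp]
    rfl
  have e2 : LinearMap.ker π ⊓ quotientDegree J (n + 1) =
      (quotientDegree J n).map (LinearMap.mulLeft k (Ideal.Quotient.mk J (lin a))) := by
    ext x
    simp only [Submodule.mem_inf, LinearMap.mem_ker, quotientDegree, Submodule.mem_map,
      exists_exists_and_eq_and, AlgHom.toLinearMap_apply, LinearMap.mulLeft_apply,
      Ideal.Quotient.mkₐ_eq_mk, mem_homogeneousSubmodule, ← map_mul]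
    constructor
    · rintro ⟨hx, f, hf, rfl⟩
      have hf' : f ∈ J ⊔ Ideal.span {lin a} := Ideal.Quotient.eq_zero_iff_mem.1 hx
      obtain ⟨v, hv, hv'⟩ := exists_sub_mul_mem hJ (isHomogeneous_lin a) hf hf'
      exact ⟨v, hv, ((Ideal.Quotient.mk_eq_mk_iff_sub_mem _ _).2 hv').symm⟩
    · rintro ⟨v, hv, rfl⟩
      refine ⟨?_, _, ?_, rfl⟩
      · refine Ideal.Quotient.eq_zero_iff_mem.2 ((le_sup_right : Ideal.span {lin a} ≤ _) ?_)
        exact Ideal.mul_mem_right _ _ (Ideal.mem_span_singleton_self _)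
      · rw [add_comm]; exact (isHomogeneous_lin a).mul hv
  rw [e1, e2] at h2
  change _ + Module.finrank k (annihilatorIn J (lin a) ⊓ quotientDegree J n : Submodule k _) = _
    at h1
  unfold hilb
  omega

lemma finrank_annihilatorIn_eq_zero_iff (J : Ideal (MvPolynomial (Fin d) k))
    (f : MvPolynomial (Fin d) k) (n : ℕ) :
    Module.finrank k (annihilatorIn J f ⊓ quotientDegree J n : Submodule k _) = 0 ↔
      ColonVanish J f n := by
  have : FiniteDimensional k (annihilatorIn J f ⊓ quotientDegree J n : Submodule k _) :=
    Submodule.finiteDimensional_of_le inf_le_right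
  rw [Submodule.finrank_eq_zero, eq_bot_iff]
  constructor
  · intro h v hv hfv
    refine Ideal.Quotient.eq_zero_iff_mem.1 ((Submodule.mem_bot k).1 (h ⟨?_, v, hv, rfl⟩))
    exact LinearMap.mem_ker.2 ((map_mul _ _ _).symm.trans (Ideal.Quotient.eq_zero_iff_mem.2 hfv))
  · rintro h _ ⟨hx, v, hv, rfl⟩
    refine (Submodule.mem_bot k).2 (Ideal.Quotient.eq_zero_iff_mem.2 (h v hv ?_))
    exact Ideal.Quotient.eq_zero_iff_mem.1 ((map_mul _ _ _).trans (LinearMap.mem_ker.1 hx))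

/-! ### Section ideals -/

section

variable (I : Ideal (MvPolynomial (Fin d) k)) (g : GL (Fin d) k)

lemma linForm_eq_lin (i : Fin d) : linForm g i = lin (g i) := rfl

/-- Generators indexed by all of `Fin d`, so that coefficients found for one matrix can be reused
for any other. -/
lemma sectionIdeal_eq_sup_range (i : ℕ) : sectionIdeal I g i =
    I ⊔ Ideal.span (Set.range fun t : Fin d => if i ≤ (t : ℕ) then linForm g t else 0) := by
  refine le_antisymm (sup_le_sup_left ?_ _) (sup_le_sup_left ?_ _)
  · refine Ideal.span_mono ?_
    rintro _ ⟨t, ht, rfl⟩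
    exact ⟨t, if_pos ht⟩
  · refine Ideal.span_le.2 ?_
    rintro _ ⟨t, rfl⟩
    dsimp only
    split_ifs with h
    exacts [Ideal.subset_span ⟨t, h, rfl⟩, Ideal.zero_mem _]

lemma linForm_mem_sectionIdeal {i : ℕ} {t : Fin d} (h : i ≤ t) :
    linForm g t ∈ sectionIdeal I g i :=
  (le_sup_right : _ ≤ sectionIdeal I g i) (Ideal.subset_span ⟨t, h, rfl⟩)

lemma sectionIdeal_self : sectionIdeal I g d = I := by
  refine le_antisymm (sup_le le_rfl (Ideal.span_le.2 ?_)) le_sup_left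
  rintro _ ⟨t, ht, rfl⟩
  exact absurd t.2 ht.not_gt

lemma sectionIdeal_eq_sup (i : Fin d) :
    sectionIdeal I g i = sectionIdeal I g (i + 1) ⊔ Ideal.span {lin (g i)} := by
  rw [sectionIdeal, sectionIdeal, sup_assoc, ← Ideal.span_union]
  congr 2
  ext f
  constructor
  · rintro ⟨t, ht, rfl⟩
    rcases Nat.lt_or_ge i t with h | h
    · exact Or.inl ⟨t, h, rfl⟩
    · obtain rfl : t = i := Fin.ext (le_antisymm h ht)
      exact Or.inr rfl
  · rintro (⟨t, ht, rfl⟩ | rfl)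
    · exact ⟨t, by omega, rfl⟩
    · exact ⟨i, le_rfl, rfl⟩

variable {I} in
lemma isHomogeneous_sectionIdeal (hI : I.IsHomogeneous (homogeneousSubmodule (Fin d) k)) (i : ℕ) :
    (sectionIdeal I g i).IsHomogeneous (homogeneousSubmodule (Fin d) k) := by
  refine hI.sup (Ideal.homogeneous_span _ _ ?_)
  rintro _ ⟨t, -, rfl⟩
  exact ⟨1, isHomogeneous_lin _⟩

lemma X_mem_sectionIdeal_zero (s : Fin d) : X s ∈ sectionIdeal I g 0 := by
  have : (X s : MvPolynomial (Fin d) k) = ∑ t, C ((g⁻¹ : GL (Fin d) k) s t) * linForm g t := by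
    have h : ∀ j, ∑ t, (g⁻¹ : GL (Fin d) k) s t * g t j = if s = j then 1 else 0 := fun j => by
      rw [← Matrix.mul_apply, ← Units.val_mul, inv_mul_cancel, Units.val_one, Matrix.one_apply]
    simp only [linForm, Finset.mul_sum]
    rw [Finset.sum_comm]
    simp only [← mul_assoc, ← C_mul, ← Finset.sum_mul, ← map_sum, h]
    simp [apply_ite C]
  rw [this]
  exact Ideal.sum_mem _ fun t _ => Ideal.mul_mem_left _ _
    (linForm_mem_sectionIdeal I g (Nat.zero_le _))

/-- The annihilator numbers, indexed by the linear form. -/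
lemma annihilatorNumber_rev (i : Fin d) (j : ℕ) : annihilatorNumber I g i.rev j =
    Module.finrank k (annihilatorIn (sectionIdeal I g (i + 1)) (lin (g i)) ⊓
      quotientDegree (sectionIdeal I g (i + 1)) j : Submodule k _) := by
  have h : d - (i.rev : ℕ) = i + 1 := by rw [Fin.val_rev]; omega
  rw [annihilatorNumber, h, Fin.rev_rev, linForm_eq_lin]

lemma annihilatorNumber_rev_eq_zero_iff (i : Fin d) (j : ℕ) :
    annihilatorNumber I g i.rev j = 0 ↔ ColonVanish (sectionIdeal I g (i + 1)) (lin (g i)) j := by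
  rw [annihilatorNumber_rev, finrank_annihilatorIn_eq_zero_iff]

variable {I} in
lemma hilb_sectionIdeal (hI : I.IsHomogeneous (homogeneousSubmodule (Fin d) k)) (i : Fin d)
    (n : ℕ) :
    hilb (sectionIdeal I g (i + 1)) n + hilb (sectionIdeal I g i) (n + 1) =
      annihilatorNumber I g i.rev n + hilb (sectionIdeal I g (i + 1)) (n + 1) := by
  rw [sectionIdeal_eq_sup, annihilatorNumber_rev,
    hilb_add_hilb_sup (isHomogeneous_sectionIdeal g hI _)]

end

/-! ### Properties of general matrices -/

/-- Over an infinite field, F times the generic determinant has a point where it does not vanish. -/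
lemma exists_GL_eval_ne_zero [Infinite k] {F : MvPolynomial (Fin d × Fin d) k} (hF : F ≠ 0) :
    ∃ g : GL (Fin d) k, eval (fun e : Fin d × Fin d => g e.1 e.2) F ≠ 0 := by
  have hne : F * (Matrix.mvPolynomialX (Fin d) (Fin d) k).det ≠ 0 :=
    mul_ne_zero hF (Matrix.det_mvPolynomialX_ne_zero (Fin d) k)
  obtain ⟨x, hx⟩ : ∃ x, eval x (F * (Matrix.mvPolynomialX (Fin d) (Fin d) k).det) ≠ 0 := by
    by_contra! h
    exact hne (MvPolynomial.funext fun x => by simpa using h x)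
  rw [map_mul] at hx
  have hdet : (Matrix.of fun i j => x (i, j)).det ≠ 0 := by
    have := right_ne_zero_of_mul hx
    rw [RingHom.map_det] at this
    convert this using 2
    ext i j
    simp [Matrix.mvPolynomialX]
  exact ⟨Matrix.GeneralLinearGroup.mkOfDetNeZero _ hdet, left_ne_zero_of_mul hx⟩

/-- A nonempty open set contains a nonempty principal one, so a single polynomial suffices. -/
lemma forGeneral_iff {P : GL (Fin d) k → Prop} : ForGeneral P ↔
    ∃ F : MvPolynomial (Fin d × Fin d) k,
      (∃ g : GL (Fin d) k, eval (fun e : Fin d × Fin d => g e.1 e.2) F ≠ 0) ∧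
      ∀ g : GL (Fin d) k, eval (fun e : Fin d × Fin d => g e.1 e.2) F ≠ 0 → P g := by
  constructor
  · rintro ⟨_, ⟨S, rfl⟩, ⟨g, F, hF, hg⟩, h⟩
    exact ⟨F, ⟨g, hg⟩, fun g' hg' => h g' ⟨F, hF, hg'⟩⟩
  · rintro ⟨F, ⟨g, hg⟩, h⟩
    refine ⟨_, ⟨{F}, rfl⟩, ⟨g, F, rfl, hg⟩, ?_⟩
    rintro g' ⟨_, rfl, hg'⟩
    exact h g' hg'

namespace ForGeneral

variable {P Q : GL (Fin d) k → Prop}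

lemma mono (h : ForGeneral P) (hPQ : ∀ g, P g → Q g) : ForGeneral Q := by
  obtain ⟨U, hU, hne, h⟩ := h
  exact ⟨U, hU, hne, fun g hg => hPQ g (h g hg)⟩

lemma exists_of (h : ForGeneral P) : ∃ g, P g := by
  obtain ⟨U, -, ⟨g, hg⟩, h⟩ := h
  exact ⟨g, h g hg⟩

lemma of_forall (h : ∀ g, P g) : ForGeneral P :=
  forGeneral_iff.2 ⟨1, ⟨1, by simp⟩, fun g _ => h g⟩

lemma and [Infinite k] (h : ForGeneral P) (h' : ForGeneral Q) : ForGeneral fun g => P g ∧ Q g := by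
  obtain ⟨F, ⟨g, hg⟩, h⟩ := forGeneral_iff.1 h
  obtain ⟨F', ⟨g', hg'⟩, h'⟩ := forGeneral_iff.1 h'
  have hF : F ≠ 0 := fun h0 => hg (by rw [h0, map_zero])
  have hF' : F' ≠ 0 := fun h0 => hg' (by rw [h0, map_zero])
  refine forGeneral_iff.2 ⟨F * F', exists_GL_eval_ne_zero (mul_ne_zero hF hF'), fun g hg => ?_⟩
  rw [map_mul] at hg
  exact ⟨h g (left_ne_zero_of_mul hg), h' g (right_ne_zero_of_mul hg)⟩

lemma forall_finset [Infinite k] {ι : Type*} (s : Finset ι) {P : ι → GL (Fin d) k → Prop}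
    (h : ∀ i ∈ s, ForGeneral (P i)) : ForGeneral fun g => ∀ i ∈ s, P i g := by
  classical
  induction s using Finset.induction_on with
  | empty => exact of_forall fun g => by simp
  | insert i s _ ih =>
    refine ((h i (Finset.mem_insert_self i s)).and
      (ih fun j hj => h j (Finset.mem_insert_of_mem hj))).mono fun g hg => ?_
    rw [Finset.forall_mem_insert]
    exact hg

end ForGeneral

lemma genericValue_eq [Infinite k] {β : Type*} [Nonempty β] {f : GL (Fin d) k → β} {b : β}
    (h : ForGeneral fun g => f g = b) : genericValue f = b := by
  have h' : ForGeneral fun g => f g = genericValue f := Classical.epsilon_spec (p := fun b =>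
    ForGeneral fun g => f g = b) ⟨b, h⟩
  obtain ⟨g, hg, hg'⟩ := (h.and h').exists_of
  rw [← hg, hg']

/-- The Hilbert function of a general section is minimal. -/
lemma forGeneral_hilb_le {I : Ideal (MvPolynomial (Fin d) k)}
    (hI : I.IsHomogeneous (homogeneousSubmodule (Fin d) k)) (i n : ℕ) :
    ForGeneral fun g => ∀ g', hilb (sectionIdeal I g i) n ≤ hilb (sectionIdeal I g' i) n := by
  obtain ⟨g₁, hg₁⟩ : ∃ g₁ : GL (Fin d) k, ∀ g',
      hilb (sectionIdeal I g₁ i) n ≤ hilb (sectionIdeal I g' i) n := by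
    obtain ⟨g₁, -, h⟩ := exists_minimalFor_of_wellFoundedLT (fun _ => True)
      (fun g : GL (Fin d) k => hilb (sectionIdeal I g i) n) ⟨1, trivial⟩
    exact ⟨g₁, fun g' => (le_total _ _).elim id fun hle => h trivial hle⟩
  set r := Module.finrank k (degreePart (sectionIdeal I g₁ i) n) with hr
  let b := Module.finBasis k (degreePart (sectionIdeal I g₁ i) n)
  have hb : ∀ a, ∃ f ∈ I, ∃ h : Fin d → MvPolynomial (Fin d) k,
      (b a : MvPolynomial (Fin d) k) =
        f + ∑ t, h t * (if i ≤ (t : ℕ) then linForm g₁ t else 0) := by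
    intro a
    have hmem : (b a : MvPolynomial (Fin d) k) ∈ sectionIdeal I g₁ i := (b a).2.1
    obtain ⟨f, hf, y, hy, hfy⟩ := Submodule.mem_sup.1 ((sectionIdeal_eq_sup_range I g₁ i).le hmem)
    obtain ⟨h, rfl⟩ := Ideal.mem_span_range_iff_exists_fun.1 hy
    exact ⟨f, hf, h, hfy.symm⟩
  choose f hf h hfh using hb
  -- The coefficients of a basis at the minimiser g₁ are kept and only the linear forms vary. The
  -- coordinates of `F g a` are then polynomials in the entries of g.
  let F : GL (Fin d) k → Fin r → MvPolynomial (Fin d) k := fun g a =>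
    homogeneousComponent n (f a + ∑ t, h a t * (if i ≤ (t : ℕ) then linForm g t else 0))
  have hF : ∀ g a, F g a ∈ degreePart (sectionIdeal I g i) n := by
    intro g a
    refine ⟨homogeneousComponent_mem_of_mem (isHomogeneous_sectionIdeal g hI i) ?_ n,
      homogeneousComponent_isHomogeneous _ _⟩
    rw [sectionIdeal_eq_sup_range]
    exact Submodule.add_mem_sup (hf a) (Ideal.mem_span_range_iff_exists_fun.2 ⟨h a, rfl⟩)
  have hF₁ : ∀ a, F g₁ a = b a := fun a => by
    simp only [F, ← hfh]
    exact homogeneousComponent_self (b a).2.2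
  have hli : LinearIndependent k fun a => (b a : MvPolynomial (Fin d) k) :=
    b.linearIndependent.map' (Submodule.subtype _) (Submodule.ker_subtype _)
  -- φ reads off coordinates in the basis, so the determinant of `M` is 1 at g₁. Where it is
  -- nonzero, the `F g a` are r independent elements of the degree n part.
  obtain ⟨φ, hφ⟩ := LinearMap.exists_leftInverse_of_injective _
    (LinearMap.ker_eq_bot.2 hli)
  let M : Matrix (Fin r) (Fin r) (MvPolynomial (Fin d × Fin d) k) := Matrix.of fun a c =>
    C (φ (homogeneousComponent n (f a)) c) + ∑ t : Fin d, ∑ j : Fin d, X (t, j) *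
      C (if i ≤ (t : ℕ) then φ (homogeneousComponent n (h a t * X j)) c else 0)
  have hM : ∀ (g : GL (Fin d) k) a c,
      eval (fun e : Fin d × Fin d => g e.1 e.2) (M a c) = φ (F g a) c := by
    intro g a c
    simp only [M, F, Matrix.of_apply, map_add, map_sum, eval_C, map_mul, eval_X,
      Finsupp.add_apply, Finsupp.finsetSum_apply]
    congr 1
    refine Finset.sum_congr rfl fun t _ => ?_
    split_ifs with ht
    · rw [linForm, Finset.mul_sum]
      simp only [map_sum, Finsupp.finsetSum_apply]
      refine Finset.sum_congr rfl fun j _ => ?_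
      have : h a t * (C (g t j) * X j) = C (g t j) * (h a t * X j) := by ring
      rw [this, homogeneousComponent_C_mul, C_mul', map_smul, Finsupp.smul_apply, smul_eq_mul]
    · simp
  have hdet : ∀ g : GL (Fin d) k, eval (fun e : Fin d × Fin d => g e.1 e.2) M.det =
      (Matrix.of fun a c => φ (F g a) c).det := by
    intro g
    rw [RingHom.map_det]
    congr 1
    ext a c
    exact hM g a c
  refine forGeneral_iff.2 ⟨M.det, ⟨g₁, ?_⟩, fun g hg g' => le_trans ?_ (hg₁ g')⟩
  · rw [hdet]
    have : (Matrix.of fun a c => φ (F g₁ a) c) = 1 := by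
      ext a c
      have := LinearMap.congr_fun hφ (Finsupp.single a 1)
      simp only [LinearMap.comp_apply, Finsupp.linearCombination_single, one_smul,
        LinearMap.id_apply] at this
      rw [Matrix.of_apply, hF₁, this, Matrix.one_apply, Finsupp.single_apply]
    rw [this, Matrix.det_one]
    exact one_ne_zero
  · rw [hdet] at hg
    have hrows := Matrix.linearIndependent_rows_of_det_ne_zero hg
    have hli' : LinearIndependent k
        fun a => (⟨F g a, hF g a⟩ : degreePart (sectionIdeal I g i) n) := by
      refine LinearIndependent.of_comp ((Finsupp.lcoeFun ∘ₗ φ) ∘ₗ Submodule.subtype _) ?_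
      exact hrows
    have hle := hli'.fintype_card_le_finrank
    rw [Fintype.card_fin] at hle
    have e1 := hilb_add_finrank_degreePart (sectionIdeal I g₁ i) n
    have e2 := hilb_add_finrank_degreePart (sectionIdeal I g i) n
    omega

/-! ### Existence of almost regular sequences -/

/-- The linear form with given coefficients, as a linear map. -/
def linMap : (Fin d → k) →ₗ[k] MvPolynomial (Fin d) k where
  toFun := lin
  map_add' a b := by simp [lin, add_mul, Finset.sum_add_distrib]
  map_smul' c a := by simp [lin, Finset.smul_sum, ← C_mul', mul_assoc]

/-- The ideal generated by the variables. -/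
abbrev irrelevantIdeal (k : Type*) [Field k] (d : ℕ) : Ideal (MvPolynomial (Fin d) k) :=
  Ideal.span (Set.range X)

lemma mem_irrelevantIdeal_pow {f : MvPolynomial (Fin d) k} {n : ℕ} (hf : f.IsHomogeneous n) :
    f ∈ irrelevantIdeal k d ^ n := by
  induction n generalizing f with
  | zero => simp
  | succ n ih =>
    obtain ⟨b, hb, rfl⟩ := exists_sum_X_mul hf
    refine Ideal.sum_mem _ fun s _ => ?_
    rw [pow_succ']
    exact Ideal.mul_mem_mul (Ideal.subset_span ⟨s, rfl⟩) (ih (hb s))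

lemma mem_of_sub_mem_of_totalDegree_lt {J : Ideal (MvPolynomial (Fin d) k)}
    (hJ : J.IsHomogeneous (homogeneousSubmodule (Fin d) k)) {f w : MvPolynomial (Fin d) k} {n : ℕ}
    (hf : f.IsHomogeneous n) (hw : w.totalDegree < n) (h : f - w ∈ J) : f ∈ J := by
  have := homogeneousComponent_mem_of_mem hJ h n
  rwa [map_sub, homogeneousComponent_self hf, homogeneousComponent_eq_zero _ _ hw, sub_zero] at this

/-- If `K` is killed modulo `J` by a power of the irrelevant ideal, then `K` and `J` agree in large
degrees. -/
lemma exists_forall_mem_of_pow_mul_le {J K : Ideal (MvPolynomial (Fin d) k)}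
    (hJ : J.IsHomogeneous (homogeneousSubmodule (Fin d) k)) {N : ℕ}
    (hK : irrelevantIdeal k d ^ N * K ≤ J) :
    ∃ D, ∀ n, D ≤ n → ∀ f ∈ K, f.IsHomogeneous n → f ∈ J := by
  obtain ⟨G, hG⟩ := (isNoetherianRing_iff_ideal_fg _).1
    (inferInstance : IsNoetherianRing (MvPolynomial (Fin d) k)) K
  -- In f = ∑ a_g g, the parts of a_g of degree at least N send g into J; what remains has degree at
  -- most N plus the largest degree of a generator, which is less than n.
  refine ⟨N + G.sup totalDegree + 1, fun n hn f hf hfn => ?_⟩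
  rw [← hG, Submodule.mem_span_finset] at hf
  obtain ⟨a, -, hf⟩ := hf
  refine mem_of_sub_mem_of_totalDegree_lt hJ hfn
    (w := ∑ g ∈ G, (∑ i ∈ Finset.range N, homogeneousComponent i (a g)) * g) ?_ ?_
  · refine lt_of_le_of_lt (totalDegree_finsetSum_le (d := N + G.sup totalDegree) fun g hg => ?_)
      (by omega)
    refine (totalDegree_mul _ _).trans (add_le_add (totalDegree_finsetSum_le fun i hi => ?_)
      (Finset.le_sup (f := totalDegree) hg))
    exact (homogeneousComponent_isHomogeneous i (a g)).totalDegree_le.trans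
      (Finset.mem_range.1 hi).le
  · rw [← hf, ← Finset.sum_sub_distrib]
    refine J.sum_mem fun g hg => ?_
    rw [smul_eq_mul, ← sub_mul]
    refine hK (Ideal.mul_mem_mul ?_ (hG ▸ Ideal.subset_span hg))
    conv => enter [2, 1]; rw [← sum_homogeneousComponent (a g)]
    have hle : N ≤ max N ((a g).totalDegree + 1) := le_max_left _ _
    have hext : ∑ i ∈ Finset.range ((a g).totalDegree + 1), homogeneousComponent i (a g) =
        ∑ i ∈ Finset.range (max N ((a g).totalDegree + 1)), homogeneousComponent i (a g) := by
      refine Finset.sum_subset (Finset.range_mono (le_max_right _ _)) fun i _ hi => ?_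
      exact homogeneousComponent_eq_zero _ _ (by simpa [Nat.lt_succ_iff] using hi)
    rw [hext, Finset.range_eq_Ico, ← Finset.sum_Ico_consecutive _ (Nat.zero_le N) hle,
      Finset.range_eq_Ico, add_sub_cancel_left]
    refine Ideal.sum_mem _ fun i hi => ?_
    exact Ideal.pow_le_pow_right (Finset.mem_Ico.1 hi).1
      (mem_irrelevantIdeal_pow (homogeneousComponent_isHomogeneous i (a g)))

/-- A homogeneous ideal has an almost regular linear form outside any proper subspace. -/
lemma exists_colonVanish [Infinite k] {J : Ideal (MvPolynomial (Fin d) k)}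
    (hJ : J.IsHomogeneous (homogeneousSubmodule (Fin d) k)) {W : Submodule k (Fin d → k)}
    (hW : W ≠ ⊤) : ∃ a ∉ W, ∃ N, ∀ n, N ≤ n → ColonVanish J (lin a) n := by
  -- K plays the role of the saturation of J: it agrees with J in large degrees, and by maximality
  -- R/K has no socle.
  obtain ⟨K, ⟨hJK, N, hN⟩, hmax⟩ := set_has_maximal_iff_noetherian.2
    (inferInstance : IsNoetherianRing (MvPolynomial (Fin d) k))
    {K | J ≤ K ∧ ∃ N, irrelevantIdeal k d ^ N * K ≤ J} ⟨J, le_rfl, 0, by simp⟩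
  have hsoc : ∀ f, (∀ s, X s * f ∈ K) → f ∈ K := by
    intro f hf
    by_contra hfK
    refine hmax (K ⊔ Ideal.span {f}) ⟨hJK.trans le_sup_left, N + 1, ?_⟩
      (lt_of_le_of_ne le_sup_left fun h => hfK ?_)
    · rw [pow_succ, mul_assoc]
      refine (Ideal.mul_mono_right ?_).trans hN
      rw [Ideal.mul_sup]
      refine sup_le Ideal.mul_le_right ?_
      rw [Ideal.span_mul_span, Ideal.span_le]
      rintro _ ⟨_, ⟨s, rfl⟩, _, rfl, rfl⟩
      exact hf s
    · rw [h]
      exact (le_sup_right : Ideal.span {f} ≤ _) (Ideal.mem_span_singleton_self f)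
  have hfin := associatedPrimes.finite (MvPolynomial (Fin d) k) (MvPolynomial (Fin d) k ⧸ K)
  classical
  let T : Ideal (MvPolynomial (Fin d) k) → Submodule k (Fin d → k) := fun P =>
    (P.restrictScalars k).comap linMap
  -- No associated prime of R/K contains all variables, so each cuts out a proper subspace of linear
  -- forms. Over an infinite field finitely many proper subspaces do not cover.
  have htop : ⊤ ∉ insert W (hfin.toFinset.image T) := by
    rw [Finset.mem_insert, Finset.mem_image]
    rintro (h | ⟨P, hP, hPT⟩)
    · exact hW h.symm
    · obtain ⟨hprime, x, hx⟩ := isAssociatedPrime_iff.1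
        (AssociatedPrimes.mem_iff.1 (hfin.mem_toFinset.1 hP))
      obtain ⟨f, rfl⟩ := Ideal.Quotient.mk_surjective x
      refine hprime.ne_top ((Ideal.eq_top_iff_one _).2 ?_)
      have hfK : f ∈ K := hsoc f fun s => by
        have hs : (Pi.single s 1 : Fin d → k) ∈ T P := hPT ▸ trivial
        have hs' : X s ∈ P := by
          have : lin (Pi.single s (1 : k)) ∈ P := hs
          rwa [lin_single] at this
        rw [hx, Submodule.mem_colon_singleton, Submodule.mem_bot] at hs'
        exact Ideal.Quotient.eq_zero_iff_mem.1 hs'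
      rw [hx, Submodule.mem_colon_singleton, Submodule.mem_bot,
        Ideal.Quotient.eq_zero_iff_mem.2 hfK, smul_zero]
  obtain ⟨a, ha⟩ := (Set.ne_univ_iff_exists_notMem _).1
    (Subspace.biUnion_ne_univ_of_top_notMem htop)
  simp only [Set.mem_iUnion, not_exists, Finset.mem_insert, Finset.mem_image] at ha
  refine ⟨a, ha W (Or.inl rfl), ?_⟩
  obtain ⟨D, hD⟩ := exists_forall_mem_of_pow_mul_le hJ hN
  refine ⟨D, fun n hn f hf hfJ => hD n hn f ?_ hf⟩
  by_contra hfK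
  have hmem : lin a ∈ {r : MvPolynomial (Fin d) k | ∃ x : MvPolynomial (Fin d) k ⧸ K,
      x ≠ 0 ∧ r • x = 0} :=
    ⟨Ideal.Quotient.mk K f, fun h => hfK (Ideal.Quotient.eq_zero_iff_mem.1 h),
      Ideal.Quotient.eq_zero_iff_mem.2 (hJK hfJ)⟩
  rw [← biUnion_associatedPrimes_eq_zero_divisors] at hmem
  simp only [Set.mem_iUnion] at hmem
  obtain ⟨P, hP, hmem⟩ := hmem
  exact ha (T P) (Or.inr ⟨P, hfin.mem_toFinset.2 hP, rfl⟩) hmem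

/-- The forms are chosen from ℓ_d down to ℓ_1, each outside the span of those already chosen, so
that the matrix is invertible. Hence `Fin.cons`: the newest form is the first row. -/
lemma exists_almostRegular [Infinite k] {I : Ideal (MvPolynomial (Fin d) k)}
    (hI : I.IsHomogeneous (homogeneousSubmodule (Fin d) k)) : ∃ (g : GL (Fin d) k) (N : ℕ),
      ∀ (i : Fin d) n, N ≤ n → ColonVanish (sectionIdeal I g (i + 1)) (lin (g i)) n := by
  have key : ∀ n, n ≤ d → ∃ v : Fin n → Fin d → k, LinearIndependent k v ∧ ∃ N, ∀ (i : Fin n) m,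
      N ≤ m → ColonVanish (I ⊔ Ideal.span {f | ∃ t : Fin n, (i : ℕ) + 1 ≤ t ∧ f = lin (v t)})
        (lin (v i)) m := by
    intro n
    induction n with
    | zero => exact fun _ => ⟨0, linearIndependent_empty_type, 0, fun i => i.elim0⟩
    | succ n ih =>
      intro hn
      obtain ⟨v, hv, N, hN⟩ := ih (by omega)
      have hW : Submodule.span k (Set.range v) ≠ ⊤ := by
        intro h
        have := finrank_span_eq_card hv
        rw [h, finrank_top, Module.finrank_fin_fun, Fintype.card_fin] at this
        omega
      have hJ : (I ⊔ Ideal.span {f | ∃ t : Fin n, f = lin (v t)}).IsHomogeneous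
          (homogeneousSubmodule (Fin d) k) := by
        refine hI.sup (Ideal.homogeneous_span _ _ ?_)
        rintro _ ⟨t, rfl⟩
        exact ⟨1, isHomogeneous_lin _⟩
      obtain ⟨a, ha, N', hN'⟩ := exists_colonVanish hJ hW
      refine ⟨Fin.cons a v, hv.finCons ha, max N N', fun i m hm => ?_⟩
      refine Fin.cases ?_ (fun i => ?_) i
      · convert hN' m (le_of_max_le_right hm) using 4
        · ext f
          rw [Fin.exists_fin_succ]
          simp
        · rfl
      · convert hN i m (le_of_max_le_left hm) using 4
        · ext f
          rw [Fin.exists_fin_succ]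
          simp
        · rfl
  obtain ⟨v, hv, N, hN⟩ := key d le_rfl
  exact ⟨(Matrix.linearIndependent_rows_iff_isUnit (A := Matrix.of v).1 hv).unit, N, hN⟩

/-! ### Sections by almost regular sequences -/

section

variable {I : Ideal (MvPolynomial (Fin d) k)}

/-- The regularity of the sections, in terms of the annihilator numbers. -/
lemma regLE_sectionIdeal_iff (hI : I.IsHomogeneous (homogeneousSubmodule (Fin d) k))
    {g : GL (Fin d) k} {N : ℕ}
    (hN : ∀ (i : Fin d) n, N ≤ n → ColonVanish (sectionIdeal I g (i + 1)) (lin (g i)) n)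
    {i : ℕ} (hi : i ≤ d) (m : ℕ) :
    RegLE (sectionIdeal I g i) m ↔
      ∀ t : Fin d, (t : ℕ) < i → ∀ j, m < j → annihilatorNumber I g t.rev j = 0 := by
  induction i with
  | zero =>
    exact iff_of_true (regLE_of_X_mem (X_mem_sectionIdeal_zero I g) m)
      fun t ht => absurd ht (Nat.not_lt_zero _)
  | succ i ih =>
    have h := regLE_iff (isHomogeneous_sectionIdeal g hI (i + 1)) (g ⟨i, hi⟩) (hN ⟨i, hi⟩) m
    rw [← sectionIdeal_eq_sup I g ⟨i, hi⟩, ih (by omega)] at h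
    rw [h]
    constructor
    · rintro ⟨h1, h2⟩ t ht j hj
      rcases Nat.lt_succ_iff_lt_or_eq.1 ht with ht | ht
      · exact h2 t ht j hj
      · obtain rfl : t = ⟨i, hi⟩ := Fin.ext ht
        exact (annihilatorNumber_rev_eq_zero_iff I g _ j).2 (h1 j hj)
    · intro h
      exact ⟨fun j hj => (annihilatorNumber_rev_eq_zero_iff I g ⟨i, hi⟩ j).1
        (h ⟨i, hi⟩ (Nat.lt_succ_self i) j hj), fun t ht => h t (by omega)⟩

/-- The first Tor of the sections vanishes in the degrees where that of `R/I` vanishes. -/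
lemma torVanish_one_sectionIdeal (hI : I.IsHomogeneous (homogeneousSubmodule (Fin d) k))
    (g : GL (Fin d) k) {n : ℕ} (h : TorVanish ⊤ I 1 n) {i : ℕ} (hi : i ≤ d) :
    TorVanish ⊤ (sectionIdeal I g i) 1 n := by
  refine Nat.decreasingInduction' (n := d) (P := fun i => TorVanish ⊤ (sectionIdeal I g i) 1 n)
    (fun j hj _ ih => ?_) hi (by rwa [sectionIdeal_self])
  rw [sectionIdeal_eq_sup I g ⟨j, hj⟩]
  exact TorVanish.sup (isHomogeneous_sectionIdeal g hI _) _ ih (TorVanish.top_zero _ _)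
    fun h => absurd rfl h

/-- If all annihilators vanish in one large degree, then they vanish in all larger degrees. -/
lemma colonVanish_persistence (hI : I.IsHomogeneous (homogeneousSubmodule (Fin d) k))
    {g : GL (Fin d) k} {m : ℕ} (h1 : ∀ n, m ≤ n → TorVanish ⊤ I 1 n)
    (hm : ∀ i : Fin d, ColonVanish (sectionIdeal I g (i + 1)) (lin (g i)) (m + 1)) (i : Fin d)
    {n : ℕ} (hn : m + 1 ≤ n) : ColonVanish (sectionIdeal I g (i + 1)) (lin (g i)) n := by
  -- Going up in degree needs Tor_2 of the quotient cut by one more form. The induction on i in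
  -- `hreg` supplies it, starting from the ideal that contains all variables.
  have step : ∀ i : Fin d, RegLE (sectionIdeal I g i) m → ∀ n, m + 1 ≤ n →
      ColonVanish (sectionIdeal I g (i + 1)) (lin (g i)) n := by
    intro i hreg n hn
    induction n, hn using Nat.le_induction with
    | base => exact hm i
    | succ n hn ih =>
      obtain ⟨n, rfl⟩ := Nat.exists_eq_succ_of_ne_zero (n := n) (by omega)
      refine ColonVanish.succ (isHomogeneous_sectionIdeal g hI _) _
        (torVanish_one_sectionIdeal hI g (h1 _ (by omega)) (by omega)) ?_ ih
      rw [← sectionIdeal_eq_sup]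
      exact hreg 2 n (by omega)
  have hreg : ∀ i ≤ d, RegLE (sectionIdeal I g i) m := by
    intro i
    induction i with
    | zero => exact fun _ => regLE_of_X_mem (X_mem_sectionIdeal_zero I g) m
    | succ i ih =>
      intro hi
      have hcol := step ⟨i, hi⟩ (ih (by omega))
      refine (regLE_iff (isHomogeneous_sectionIdeal g hI (i + 1)) (g ⟨i, hi⟩) hcol m).2
        ⟨fun n hn => hcol n hn, ?_⟩
      rw [← sectionIdeal_eq_sup I g ⟨i, hi⟩]
      exact ih (by omega)
  exact step i (hreg i (by omega)) n hn

/-- General matrices: the annihilators vanish in a fixed range of degrees, and the Hilbert functions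
of the sections are minimal in the remaining degrees. -/
lemma forGeneral_colonVanish [Infinite k]
    (hI : I.IsHomogeneous (homogeneousSubmodule (Fin d) k)) (B : ℕ) : ∃ N, B ≤ N ∧
      ForGeneral fun g => (∀ (i : Fin d) n, N ≤ n →
        ColonVanish (sectionIdeal I g (i + 1)) (lin (g i)) n) ∧
        ∀ i ≤ d, ∀ n ≤ N, ∀ g', hilb (sectionIdeal I g i) n ≤ hilb (sectionIdeal I g' i) n := by
  obtain ⟨g₀, N₀, h₀⟩ := exists_almostRegular hI
  have hreg : RegLE I N₀ := by
    have := (regLE_sectionIdeal_iff hI h₀ le_rfl N₀).2 fun t _ j hj =>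
      (annihilatorNumber_rev_eq_zero_iff I g₀ t j).2 (h₀ t j hj.le)
    rwa [sectionIdeal_self] at this
  -- The descending comparison `heq` loses one degree for each form; adding d leaves room for all of
  -- them.
  let m := max N₀ B + d
  refine ⟨m + 1, by omega, ?_⟩
  have hgen := ForGeneral.forall_finset (k := k) (d := d)
    (Finset.range (d + 1) ×ˢ Finset.range (m + 3)) (P := fun p g => ∀ g',
      hilb (sectionIdeal I g p.1) p.2 ≤ hilb (sectionIdeal I g' p.1) p.2)
    fun p _ => forGeneral_hilb_le hI p.1 p.2
  refine hgen.mono fun g hg => ?_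
  have hmin : ∀ i ≤ d, ∀ n ≤ m + 2, ∀ g',
      hilb (sectionIdeal I g i) n ≤ hilb (sectionIdeal I g' i) n := fun i hi n hn =>
    hg (i, n) (by simp only [Finset.mem_product, Finset.mem_range]; omega)
  refine ⟨?_, fun i hi n hn => hmin i hi n (by omega)⟩
  -- If g and g₀ agree before the cut, then after it the Hilbert function of g exceeds that of g₀ by
  -- the annihilator number of g. Minimality forces this number to be 0.
  have hstep : ∀ (i : Fin d) j, N₀ ≤ j → j ≤ m + 1 →
      hilb (sectionIdeal I g (i + 1)) j = hilb (sectionIdeal I g₀ (i + 1)) j →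
      hilb (sectionIdeal I g (i + 1)) (j + 1) = hilb (sectionIdeal I g₀ (i + 1)) (j + 1) →
      hilb (sectionIdeal I g i) (j + 1) = hilb (sectionIdeal I g₀ i) (j + 1) ∧
        annihilatorNumber I g i.rev j = 0 := by
    intro i j hj hjm e1 e2
    have a1 := hilb_sectionIdeal g hI i j
    have a2 := hilb_sectionIdeal g₀ hI i j
    have a3 := (annihilatorNumber_rev_eq_zero_iff I g₀ i j).2 (h₀ i j hj)
    have a4 := hmin i (by omega) (j + 1) (by omega) g₀
    omega
  have heq : ∀ t ≤ d, ∀ j, N₀ + t ≤ j → j ≤ m + 2 →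
      hilb (sectionIdeal I g (d - t)) j = hilb (sectionIdeal I g₀ (d - t)) j := by
    intro t
    induction t with
    | zero => intro _ j _ _; rw [Nat.sub_zero, sectionIdeal_self, sectionIdeal_self]
    | succ t ih =>
      intro ht j hj hjm
      obtain ⟨j, rfl⟩ := Nat.exists_eq_succ_of_ne_zero (n := j) (by omega)
      have ih := ih (by omega)
      rw [show d - t = d - (t + 1) + 1 by omega] at ih
      exact (hstep ⟨d - (t + 1), by omega⟩ j (by omega) (by omega) (ih j (by omega) (by omega))
        (ih (j + 1) (by omega) (by omega))).1
  intro i n hn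
  -- Vanishing in the single degree m + 1 is enough, which finitely many open conditions can
  -- guarantee.
  refine colonVanish_persistence hI (fun n hn => hreg 1 n (by omega)) (fun i => ?_) i hn
  have heq := heq (d - (i + 1)) (by omega)
  rw [show d - (d - ((i : ℕ) + 1)) = i + 1 by omega] at heq
  exact (annihilatorNumber_rev_eq_zero_iff I g i _).1 (hstep i (m + 1) (by omega) le_rfl
    (heq _ (by omega) (by omega)) (heq _ (by omega) (by omega))).2

lemma finiteDimensional_annihilatorIn {J : Ideal (MvPolynomial (Fin d) k)}
    (hJ : J.IsHomogeneous (homogeneousSubmodule (Fin d) k)) (a : Fin d → k) {N : ℕ}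
    (hN : ∀ n, N ≤ n → ColonVanish J (lin a) n) :
    FiniteDimensional k (annihilatorIn J (lin a)) := by
  have : FiniteDimensional k (⨆ i : Fin N, quotientDegree J i : Submodule k _) :=
    Submodule.finiteDimensional_iSup _
  refine Submodule.finiteDimensional_of_le (S₂ := ⨆ i : Fin N, quotientDegree J i) ?_
  intro x hx
  obtain ⟨f, rfl⟩ := Ideal.Quotient.mk_surjective x
  have hf : lin a * f ∈ J := Ideal.Quotient.eq_zero_iff_mem.1
    ((map_mul _ _ _).trans (LinearMap.mem_ker.1 hx))
  rw [← sum_homogeneousComponent f, map_sum]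
  refine Submodule.sum_mem _ fun i _ => ?_
  by_cases hi : i < N
  · refine Submodule.mem_iSup_of_mem ⟨i, hi⟩ ⟨_, homogeneousComponent_isHomogeneous i f, rfl⟩
  · have hmem := homogeneousComponent_mem_of_mem hJ hf (1 + i)
    rw [homogeneousComponent_mul_of_left (isHomogeneous_lin a)] at hmem
    have := hN i (not_lt.1 hi) _ (homogeneousComponent_isHomogeneous i f) hmem
    rw [Ideal.Quotient.eq_zero_iff_mem.2 this]
    exact Submodule.zero_mem _

end

/-! ### Degenerate section ideals -/

section

variable {I : Ideal (MvPolynomial (Fin d) k)}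

/-- Column t of g⁻¹ is the point dual to ℓ_t; evaluation there separates ℓ_t from the other forms.
-/
lemma eval_inv_linForm (g : GL (Fin d) k) (s t : Fin d) :
    eval (fun j => (g⁻¹ : GL (Fin d) k) j t) (linForm g s) = if s = t then 1 else 0 := by
  simp only [linForm, map_sum, map_mul, eval_C, eval_X]
  rw [← Matrix.mul_apply, ← Units.val_mul, mul_inv_cancel, Units.val_one, Matrix.one_apply]

lemma coeff_zero_eq_zero_of_mem (hI : I.IsHomogeneous (homogeneousSubmodule (Fin d) k))
    (hIt : I ≠ ⊤) {f : MvPolynomial (Fin d) k} (hf : f ∈ I) : coeff 0 f = 0 := by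
  by_contra hne
  have := homogeneousComponent_mem_of_mem hI hf 0
  rw [homogeneousComponent_zero] at this
  exact hIt (Ideal.eq_top_of_isUnit_mem _ this ((isUnit_iff_ne_zero.2 hne).map C))

lemma sectionIdeal_eq_top_iff (hI : I.IsHomogeneous (homogeneousSubmodule (Fin d) k))
    (g : GL (Fin d) k) (i : ℕ) : sectionIdeal I g i = ⊤ ↔ I = ⊤ := by
  refine ⟨fun h => ?_, fun h => by rw [h]; exact top_sup_eq _⟩
  by_contra hIt
  have hle : sectionIdeal I g i ≤ RingHom.ker (constantCoeff (σ := Fin d) (R := k)) := by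
    refine sup_le (fun f hf => coeff_zero_eq_zero_of_mem hI hIt hf) (Ideal.span_le.2 ?_)
    rintro _ ⟨t, -, rfl⟩
    simp [linForm, RingHom.mem_ker]
  have := hle (h ▸ Submodule.mem_top : (1 : MvPolynomial (Fin d) k) ∈ _)
  simp [RingHom.mem_ker] at this

lemma sectionIdeal_eq_bot_iff (g : GL (Fin d) k) {i : ℕ} (hi : i ≤ d) :
    sectionIdeal I g i = ⊥ ↔ I = ⊥ ∧ i = d := by
  refine ⟨fun h => ⟨?_, ?_⟩, ?_⟩
  · exact le_bot_iff.1 (h ▸ le_sup_left)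
  · by_contra hne
    have hlt : i < d := lt_of_le_of_ne hi hne
    have hmem := linForm_mem_sectionIdeal I g (i := i) (t := ⟨i, hlt⟩) le_rfl
    rw [h, Submodule.mem_bot] at hmem
    have := eval_inv_linForm g ⟨i, hlt⟩ ⟨i, hlt⟩
    simp [hmem] at this
  · rintro ⟨rfl, rfl⟩
    exact sectionIdeal_self _ g

lemma annihilatorNumber_top (g : GL (Fin d) k) (s : Fin d) (j : ℕ) :
    annihilatorNumber (⊤ : Ideal (MvPolynomial (Fin d) k)) g s j = 0 := by
  rw [← Fin.rev_rev s, annihilatorNumber_rev_eq_zero_iff]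
  exact fun h _ _ => (le_sup_left : ⊤ ≤ sectionIdeal ⊤ g _) trivial

/-- Positive degrees follow from reg R = 0. In degree 0, a constant multiple of ℓ_t in the ideal of
the later forms is 0, by evaluation at the dual point. -/
lemma annihilatorNumber_bot {g : GL (Fin d) k} {N : ℕ}
    (hN : ∀ (i : Fin d) n, N ≤ n → ColonVanish (sectionIdeal ⊥ g (i + 1)) (lin (g i)) n)
    (s : Fin d) (j : ℕ) :
    annihilatorNumber (⊥ : Ideal (MvPolynomial (Fin d) k)) g s j = 0 := by
  rw [← Fin.rev_rev s]
  generalize s.rev = t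
  rcases Nat.eq_zero_or_pos j with rfl | hj
  · rw [annihilatorNumber_rev_eq_zero_iff]
    intro h hh hmem
    obtain ⟨c, rfl⟩ : ∃ c, h = C c :=
      ⟨coeff 0 h, by rw [← homogeneousComponent_zero, homogeneousComponent_self hh]⟩
    have hle : sectionIdeal ⊥ g (t + 1) ≤
        RingHom.ker (eval fun j => (g⁻¹ : GL (Fin d) k) j t) := by
      refine sup_le bot_le (Ideal.span_le.2 ?_)
      rintro _ ⟨s, hs, rfl⟩
      have hne : s ≠ t := by rintro rfl; omega
      rw [SetLike.mem_coe, RingHom.mem_ker, eval_inv_linForm, if_neg hne]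
    have := hle hmem
    rw [RingHom.mem_ker, map_mul, ← linForm_eq_lin, eval_inv_linForm, if_pos rfl, eval_C,
      one_mul] at this
    rw [this, C_0]
    exact Ideal.zero_mem _
  · refine (regLE_sectionIdeal_iff (Ideal.IsHomogeneous.bot _) hN le_rfl 0).1 ?_ t t.2 j hj
    rw [sectionIdeal_self]
    exact regLE_bot

/-- `RegLE` determines the regularity only of nonzero proper ideals, so the zero and unit ideals are
matched separately. -/
lemma idealRegularity_congr {J J' : Ideal (MvPolynomial (Fin d) k)}
    (hJ : J.IsHomogeneous (homogeneousSubmodule (Fin d) k))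
    (hJ' : J'.IsHomogeneous (homogeneousSubmodule (Fin d) k)) (hb : J = ⊥ ↔ J' = ⊥)
    (ht : J = ⊤ ↔ J' = ⊤) (h : ∀ m, RegLE J m ↔ RegLE J' m) (hex : ∃ m, RegLE J m) :
    idealRegularity J = idealRegularity J' := by
  by_cases hJb : J = ⊥
  · rw [hJb, hb.1 hJb]
  by_cases hJt : J = ⊤
  · rw [hJt, ht.1 hJt]
  classical
  rw [idealRegularity_eq hJ hJb hJt (Nat.find_spec hex) fun m hm => Nat.find_min hex hm,
    idealRegularity_eq hJ' (mt hb.2 hJb) (mt ht.2 hJt) ((h _).1 (Nat.find_spec hex))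
      fun m hm => mt (h m).2 (Nat.find_min hex hm)]

/-! ### General sections of dimension one -/

lemma aeval_mul_of_isHomogeneous {A : Type*} [CommRing A] [Algebra k A]
    {f : MvPolynomial (Fin d) k} {n : ℕ} (hf : f.IsHomogeneous n) (t : A) (y : Fin d → A) :
    aeval (fun i => y i * t) f = aeval y f * t ^ n := by
  rw [aeval_def, aeval_def, eval₂_eq, eval₂_eq, Finset.sum_mul]
  refine Finset.sum_congr rfl fun m hm => ?_
  simp only [mul_pow, Finset.prod_mul_distrib]
  rw [Finset.prod_pow_eq_pow_sum, mul_assoc]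
  congr 3
  rw [hf.degree_eq_sum_deg_support hm]

/-- A nonzero homogeneous ideal contains, modulo some linear forms `ℓ_2, …, ℓ_d`, all forms of some
degree. -/
lemma exists_hilb_sectionIdeal_one_eq_zero [Infinite k]
    (hI : I.IsHomogeneous (homogeneousSubmodule (Fin d) k)) (hIb : I ≠ ⊥) (hd : 0 < d) :
    ∃ (g : GL (Fin d) k) (n : ℕ), hilb (sectionIdeal I g 1) n = 0 := by
  let z : Fin d := ⟨0, hd⟩
  obtain ⟨f₀, hf₀, hne⟩ := Submodule.exists_mem_ne_zero_of_ne_bot hIb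
  obtain ⟨n, hn⟩ : ∃ n, homogeneousComponent n f₀ ≠ 0 := by
    by_contra! h
    exact hne (by rw [← sum_homogeneousComponent f₀]; exact Finset.sum_eq_zero fun i _ => h i)
  set f := homogeneousComponent n f₀
  have hf : f.IsHomogeneous n := homogeneousComponent_isHomogeneous n f₀
  have hfI : f ∈ I := homogeneousComponent_mem_of_mem hI hf₀ n
  -- A point where f and x_z are both nonzero can be rescaled to c with z-coordinate 1 and f(c) ≠ 0.
  obtain ⟨w, hw⟩ : ∃ w, eval w (f * X z) ≠ 0 := by
    by_contra! h
    exact mul_ne_zero hn (X_ne_zero z) (MvPolynomial.funext fun x => by simpa using h x)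
  rw [map_mul, eval_X] at hw
  have hwz : w z ≠ 0 := right_ne_zero_of_mul hw
  let c : Fin d → k := fun i => w i / w z
  have hc : eval c f ≠ 0 := by
    intro h0
    have h1 := aeval_mul_of_isHomogeneous hf (w z) c
    have h2 : (fun i => c i * w z) = w := funext fun i => div_mul_cancel₀ _ hwz
    rw [h2] at h1
    have h3 : ∀ v : Fin d → k, aeval v f = eval v f := fun v =>
      RingHom.congr_fun (coe_aeval_eq_eval v) f
    rw [h3, h3, h0, zero_mul] at h1
    exact left_ne_zero_of_mul hw h1
  -- The rows other than z are the forms x_i - c_i x_z. Modulo these, a form h of degree n becomes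
  -- h(c) x_z^n; taking h = f kills x_z^n.
  let M : Matrix (Fin d) (Fin d) k := Matrix.of fun i j =>
    if i = j then 1 else if j = z then -c i else 0
  have hM : M.det = 1 := by
    have hlow : M.IsLowerTriangular := by
      intro i j hij
      have hij' : i < j := hij
      have h1 : i ≠ j := hij'.ne
      have h2 : j ≠ z := by
        rintro rfl
        exact absurd hij' (Nat.not_lt_zero _)
      simp [M, h1, h2]
    rw [Matrix.det_of_isLowerTriangular M hlow]
    simp [M]
  let g : GL (Fin d) k := Matrix.GeneralLinearGroup.mkOfDetNeZero M (by rw [hM]; exact one_ne_zero)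
  refine ⟨g, n, ?_⟩
  set J := sectionIdeal I g 1
  have hX : ∀ i, X i - C (c i) * X z ∈ J := by
    intro i
    by_cases hi : i = z
    · have : c i = 1 := by rw [hi]; exact div_self hwz
      rw [this, hi]
      simp
    · have hmem := linForm_mem_sectionIdeal I g (i := 1) (t := i)
        (Nat.one_le_iff_ne_zero.2 fun h => hi (Fin.ext h))
      convert hmem using 1
      have hterm : ∀ j, C (g i j) * X j = (if j = i then X i else 0) +
          (if j = z then -(C (c i) * X z) else 0 : MvPolynomial (Fin d) k) := by
        intro j
        have hg : g i j = if i = j then 1 else if j = z then -c i else 0 := rfl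
        rw [hg]
        by_cases h1 : j = i
        · subst h1; simp [hi]
        · by_cases h2 : j = z
          · subst h2; simp [h1, Ne.symm h1]
          · simp [h1, h2, Ne.symm h1]
      rw [linForm, Finset.sum_congr rfl fun j _ => hterm j, Finset.sum_add_distrib]
      simp [sub_eq_add_neg]
  have hmod : ∀ h : MvPolynomial (Fin d) k, h.IsHomogeneous n →
      h - C (eval c h) * X z ^ n ∈ J := by
    intro h hh
    rw [← Ideal.Quotient.mk_eq_mk_iff_sub_mem]
    have e1 := aeval_mul_of_isHomogeneous (A := MvPolynomial (Fin d) k ⧸ J) hh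
      (Ideal.Quotient.mk J (X z)) fun i => algebraMap k _ (c i)
    have e2 : (fun i => algebraMap k (MvPolynomial (Fin d) k ⧸ J) (c i) *
        Ideal.Quotient.mk J (X z)) = fun i => Ideal.Quotient.mkₐ k J (X i) := by
      funext i
      have := (Ideal.Quotient.mk_eq_mk_iff_sub_mem _ _).2 (hX i)
      rw [map_mul] at this
      exact this.symm
    have e3 : aeval (fun i => algebraMap k (MvPolynomial (Fin d) k ⧸ J) (c i)) h =
        algebraMap k (MvPolynomial (Fin d) k ⧸ J) (eval c h) := by
      rw [← coe_aeval_eq_eval, RingHom.coe_coe]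
      exact aeval_algebraMap_apply _ c h
    have e4 : aeval (fun i => Ideal.Quotient.mkₐ k J (X i)) h = Ideal.Quotient.mkₐ k J h := by
      rw [← comp_aeval_apply, aeval_X_left_apply]
    rw [e2, e3, e4] at e1
    rw [map_mul, map_pow]
    exact e1
  have hXn : X z ^ n ∈ J := by
    have h1 := J.sub_mem ((le_sup_left : I ≤ J) hfI) (hmod f hf)
    rw [sub_sub_cancel] at h1
    have h2 := J.mul_mem_left (C (eval c f)⁻¹) h1
    rwa [← mul_assoc, ← C_mul, inv_mul_cancel₀ hc, C_1, one_mul] at h2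
  rw [hilb, Submodule.finrank_eq_zero, eq_bot_iff]
  rintro _ ⟨h, hh, rfl⟩
  refine (Submodule.mem_bot k).2 (Ideal.Quotient.eq_zero_iff_mem.2 ?_)
  have := J.add_mem (hmod h hh) (J.mul_mem_left (C (eval c h)) hXn)
  rwa [sub_add_cancel] at this

/-- Otherwise ℓ_1 could be cancelled from ℓ_1^n = 0 in R/(I+(ℓ_2, …, ℓ_d)) until 1 = 0, although I
is proper. -/
lemma exists_annihilatorNumber_ne_zero (hI : I.IsHomogeneous (homogeneousSubmodule (Fin d) k))
    (hIt : I ≠ ⊤) {g : GL (Fin d) k} {n : ℕ} (h : hilb (sectionIdeal I g 1) n = 0) {z : Fin d}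
    (hz : (z : ℕ) = 0) : ∃ j, annihilatorNumber I g z.rev j ≠ 0 := by
  by_contra! hcon
  have hcol : ∀ j, ColonVanish (sectionIdeal I g 1) (lin (g z)) j := fun j => by
    have := (annihilatorNumber_rev_eq_zero_iff I g z j).1 (hcon j)
    rwa [hz] at this
  rw [hilb, Submodule.finrank_eq_zero, eq_bot_iff] at h
  have hpow : ∀ j, (lin (g z) ^ j).IsHomogeneous j := fun j => by
    simpa using (isHomogeneous_lin (g z)).pow j
  have hmem : lin (g z) ^ n ∈ sectionIdeal I g 1 :=
    Ideal.Quotient.eq_zero_iff_mem.1 ((Submodule.mem_bot k).1 (h ⟨_, hpow n, rfl⟩))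
  have hone : lin (g z) ^ 0 ∈ sectionIdeal I g 1 := by
    induction n with
    | zero => exact hmem
    | succ n ih =>
      refine Nat.decreasingInduction' (n := n + 1)
        (P := fun j => lin (g z) ^ j ∈ sectionIdeal I g 1)
        (fun j _ _ hj => hcol j _ (hpow j) (by rwa [← pow_succ'])) (Nat.zero_le _) hmem
  rw [pow_zero] at hone
  exact hIt ((sectionIdeal_eq_top_iff hI g 1).1 ((Ideal.eq_top_iff_one _).2 hone))

/-! ### Sectional regularities and generic annihilator numbers -/

/-- The invariants are computed by general matrices. -/
theorem forGeneral_sections [Infinite k] (hI : I.IsHomogeneous (homogeneousSubmodule (Fin d) k)) :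
    ∃ N, ForGeneral fun g =>
      (∀ (i : Fin d) n, N ≤ n → ColonVanish (sectionIdeal I g (i + 1)) (lin (g i)) n) ∧
      (∀ i ≤ d, idealRegularity (sectionIdeal I g i) = sreg I i) ∧
      (annihilatorNumber I g = genericAnnihilatorNumber I) ∧
      (I ≠ ⊥ → I ≠ ⊤ → ∀ z : Fin d, (z : ℕ) = 0 → ∃ j, annihilatorNumber I g z.rev j ≠ 0) := by
  obtain ⟨B, hB⟩ : ∃ B, I ≠ ⊥ → 0 < d →
      ∃ g : GL (Fin d) k, hilb (sectionIdeal I g 1) B = 0 := by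
    by_cases h : I ≠ ⊥ ∧ 0 < d
    · obtain ⟨g, n, hg⟩ := exists_hilb_sectionIdeal_one_eq_zero hI h.1 h.2
      exact ⟨n, fun _ _ => ⟨g, hg⟩⟩
    · exact ⟨0, fun h1 h2 => absurd ⟨h1, h2⟩ h⟩
  obtain ⟨N, hBN, hgen⟩ := forGeneral_colonVanish hI B
  obtain ⟨g₁, hg₁, hmin₁⟩ := hgen.exists_of
  -- From N on both tables vanish; below N they are computed by `hilb_sectionIdeal` from the same
  -- minimal Hilbert functions.
  have hann : ForGeneral fun g => annihilatorNumber I g = annihilatorNumber I g₁ := by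
    refine hgen.mono fun g ⟨hg, hmin⟩ => ?_
    funext s j
    rw [← Fin.rev_rev s]
    generalize s.rev = t
    by_cases hj : N ≤ j
    · rw [(annihilatorNumber_rev_eq_zero_iff I g t j).2 (hg t j hj),
        (annihilatorNumber_rev_eq_zero_iff I g₁ t j).2 (hg₁ t j hj)]
    · have e : ∀ i ≤ d, ∀ n ≤ N, hilb (sectionIdeal I g i) n = hilb (sectionIdeal I g₁ i) n :=
        fun i hi n hn => le_antisymm (hmin i hi n hn g₁) (hmin₁ i hi n hn g)
      have h1 := hilb_sectionIdeal g hI t j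
      have h2 := hilb_sectionIdeal g₁ hI t j
      rw [e _ (by omega) j (by omega), e _ (by omega) (j + 1) (by omega),
        e _ (by omega) (j + 1) (by omega)] at h1
      omega
  have hreg : ∀ i ≤ d, ForGeneral fun g =>
      idealRegularity (sectionIdeal I g i) = idealRegularity (sectionIdeal I g₁ i) := by
    intro i hi
    refine (hgen.and hann).mono fun g ⟨⟨hg, _⟩, hga⟩ => ?_
    refine idealRegularity_congr (isHomogeneous_sectionIdeal g hI i)
      (isHomogeneous_sectionIdeal g₁ hI i) ?_ ?_ (fun m => ?_) ⟨N, ?_⟩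
    · rw [sectionIdeal_eq_bot_iff g hi, sectionIdeal_eq_bot_iff g₁ hi]
    · rw [sectionIdeal_eq_top_iff hI, sectionIdeal_eq_top_iff hI]
    · rw [regLE_sectionIdeal_iff hI hg hi, regLE_sectionIdeal_iff hI hg₁ hi, hga]
    · exact (regLE_sectionIdeal_iff hI hg hi N).2 fun t _ j hj =>
        (annihilatorNumber_rev_eq_zero_iff I g t j).2 (hg t j hj.le)
  refine ⟨N, (hgen.and (hann.and (ForGeneral.forall_finset (Finset.range (d + 1))
    (P := fun i g => idealRegularity (sectionIdeal I g i) = idealRegularity (sectionIdeal I g₁ i))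
    fun i hi => hreg i (by simpa [Nat.lt_succ_iff] using hi)))).mono
    fun g ⟨⟨hg, hmin⟩, hga, hgr⟩ => ⟨hg, fun i hi => ?_, ?_, fun hIb hIt z hz => ?_⟩⟩
  · rw [hgr i (Finset.mem_range.2 (by omega))]
    exact (genericValue_eq (hreg i hi)).symm
  · rw [hga]
    exact (genericValue_eq hann).symm
  · obtain ⟨g', hg'⟩ := hB hIb z.pos
    exact exists_annihilatorNumber_ne_zero hI hIt
      (Nat.le_zero.1 ((hmin 1 z.pos B hBN g').trans hg'.le)) hz

lemma genericAnnihilatorNumber_eq_zero [Infinite k]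
    (hI : I.IsHomogeneous (homogeneousSubmodule (Fin d) k)) (h : I = ⊥ ∨ I = ⊤) (s : Fin d)
    (j : ℕ) : genericAnnihilatorNumber I s j = 0 := by
  obtain ⟨N, hgen⟩ := forGeneral_sections hI
  obtain ⟨g, hg, -, hga, -⟩ := hgen.exists_of
  rw [← hga]
  rcases h with rfl | rfl
  exacts [annihilatorNumber_bot hg s j, annihilatorNumber_top g s j]

/-- The sectional regularities in terms of the generic annihilator numbers. -/
lemma exists_sreg_eq [Infinite k] (hI : I.IsHomogeneous (homogeneousSubmodule (Fin d) k))
    (hIt : I ≠ ⊤) {i : ℕ} (hi : i ≤ d) (hIb : I ≠ ⊥ ∨ i < d) :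
    ∃ m : ℕ, sreg I i = (m : EReal) + 1 ∧
      (∀ t : Fin d, (t : ℕ) < i → ∀ j, m < j → genericAnnihilatorNumber I t.rev j = 0) ∧
      (0 < m → ∃ t : Fin d, (t : ℕ) < i ∧ genericAnnihilatorNumber I t.rev m ≠ 0) := by
  obtain ⟨N, hgen⟩ := forGeneral_sections hI
  obtain ⟨g, hg, hgr, hga, -⟩ := hgen.exists_of
  have hiff := regLE_sectionIdeal_iff hI hg hi
  have hex : ∃ m, RegLE (sectionIdeal I g i) m := ⟨N, (hiff N).2 fun t _ j hj =>
    (annihilatorNumber_rev_eq_zero_iff I g t j).2 (hg t j hj.le)⟩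
  classical
  have hspec := (hiff _).1 (Nat.find_spec hex)
  refine ⟨Nat.find hex, ?_, fun t ht j hj => hga ▸ hspec t ht j hj, fun hpos => ?_⟩
  · rw [← hgr i hi]
    refine idealRegularity_eq (isHomogeneous_sectionIdeal g hI i) ?_
      (mt (sectionIdeal_eq_top_iff hI g i).1 hIt) (Nat.find_spec hex)
      fun m hm => Nat.find_min hex hm
    rw [Ne, sectionIdeal_eq_bot_iff g hi]
    rintro ⟨h1, h2⟩
    exact hIb.elim (fun h => h h1) fun h => h.ne h2
  · by_contra! h
    refine Nat.find_min hex (Nat.sub_lt hpos one_pos) ((hiff _).2 fun t ht j hj => ?_)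
    rcases Nat.lt_or_ge (Nat.find hex) j with hlt | hge
    · exact hspec t ht j hlt
    · rw [show j = Nat.find hex by omega, hga]
      exact h t ht

/-- Here m is an attained maximum even when m = 0: ℓ_1 has a nonzero annihilator, which then must
sit in degree 0. -/
lemma exists_sreg_succ_eq [Infinite k] (hI : I.IsHomogeneous (homogeneousSubmodule (Fin d) k))
    (hIb : I ≠ ⊥) (hIt : I ≠ ⊤) (i : Fin d) :
    ∃ m : ℕ, sreg I (i + 1) = (m : EReal) + 1 ∧
      (∀ t ≤ i, ∀ j, m < j → genericAnnihilatorNumber I t.rev j = 0) ∧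
      ∃ t ≤ i, genericAnnihilatorNumber I t.rev m ≠ 0 := by
  obtain ⟨m, h1, h2, h3⟩ := exists_sreg_eq hI hIt (i := i + 1) i.2 (Or.inl hIb)
  refine ⟨m, h1, fun t ht => h2 t (Nat.lt_succ_of_le ht), ?_⟩
  rcases Nat.eq_zero_or_pos m with rfl | hm
  · obtain ⟨N, hgen⟩ := forGeneral_sections hI
    obtain ⟨g, -, -, hga, hgz⟩ := hgen.exists_of
    obtain ⟨j, hj⟩ := hgz hIb hIt ⟨0, i.pos⟩ rfl
    rw [hga] at hj
    refine ⟨⟨0, i.pos⟩, Nat.zero_le _, ?_⟩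
    rcases Nat.eq_zero_or_pos j with rfl | hj0
    · exact hj
    · exact absurd (h2 _ (Nat.succ_pos _) j hj0) hj
  · obtain ⟨t, ht, ht'⟩ := h3 hm
    exact ⟨t, Nat.le_of_lt_succ ht, ht'⟩

/-! ### Coextremal entries and the jumps of the sectional regularities -/

lemma isCoextremal_rev_iff (i : Fin d) (j : ℕ) : IsCoextremal I i.rev j ↔
    genericAnnihilatorNumber I i.rev j ≠ 0 ∧ ∀ t ≤ i, ∀ j', j ≤ j' → (t, j') ≠ (i, j) →
      genericAnnihilatorNumber I t.rev j' = 0 := by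
  refine and_congr_right fun _ => ⟨fun h t ht j' hj hne => ?_, fun h s j' hne hs hj => ?_⟩
  · refine h t.rev j' (fun heq => hne ?_) (Fin.rev_le_rev.2 ht) hj
    rw [Prod.mk.injEq] at heq ⊢
    exact ⟨Fin.rev_injective heq.1, heq.2⟩
  · rw [← Fin.rev_rev s] at hs hne ⊢
    refine h _ (Fin.rev_le_rev.1 hs) j' hj fun heq => hne ?_
    rw [Prod.mk.injEq] at heq ⊢
    exact ⟨by rw [heq.1], heq.2⟩

lemma natCast_add_one_lt_iff {m n : ℕ} : (m : EReal) + 1 < (n : EReal) + 1 ↔ m < n := by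
  have : ((m + 1 : ℕ) : EReal) < ((n + 1 : ℕ) : EReal) ↔ m < n := by
    rw [EReal.natCast_lt_iff]; omega
  simpa using this

lemma natCast_add_one_inj {m n : ℕ} : (m : EReal) + 1 = (n : EReal) + 1 ↔ m = n := by
  have : ((m + 1 : ℕ) : EReal) = ((n + 1 : ℕ) : EReal) ↔ m = n := by
    rw [EReal.natCast_eq_iff]; omega
  simpa using this

lemma sreg_top [Infinite k] {i : ℕ} (hi : i ≤ d) :
    sreg (⊤ : Ideal (MvPolynomial (Fin d) k)) i = 0 := by
  obtain ⟨N, hgen⟩ := forGeneral_sections (k := k) (d := d) (Ideal.IsHomogeneous.top _)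
  obtain ⟨g, -, hgr, -, -⟩ := hgen.exists_of
  rw [← hgr i hi, (sectionIdeal_eq_top_iff (Ideal.IsHomogeneous.top _) g i).2 rfl,
    idealRegularity_top]

/-- If all annihilator numbers vanish, the sequence of sectional regularities has no jumps. -/
lemma not_sreg_lt [Infinite k] (hI : I.IsHomogeneous (homogeneousSubmodule (Fin d) k))
    (h : I = ⊥ ∨ I = ⊤) (i : Fin d) : ¬ sreg I i < sreg I (i + 1) := by
  have hzero := genericAnnihilatorNumber_eq_zero hI h
  by_cases hIt : I = ⊤
  · subst hIt
    rw [sreg_top (by omega), sreg_top (by omega)]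
    exact lt_irrefl _
  have hIb : I = ⊥ := h.resolve_right hIt
  rcases Nat.lt_or_ge (i + 1) d with hi | hi
  · have hone : ∀ i < d, sreg I i = ((0 : ℕ) : EReal) + 1 := by
      intro i hi
      obtain ⟨m, h1, -, h3⟩ := exists_sreg_eq hI hIt hi.le (Or.inr hi)
      rcases Nat.eq_zero_or_pos m with rfl | hm
      · exact h1
      · obtain ⟨t, -, ht⟩ := h3 hm
        exact absurd (hzero _ _) ht
    rw [hone _ hi, hone _ i.2]
    exact lt_irrefl _
  · obtain ⟨N, hgen⟩ := forGeneral_sections hI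
    obtain ⟨g, -, hgr, -, -⟩ := hgen.exists_of
    rw [← hgr (i + 1) i.2, (sectionIdeal_eq_bot_iff g i.2).2 ⟨hIb, le_antisymm i.2 hi⟩,
      idealRegularity_bot]
    exact not_lt_bot

lemma sreg_eq_of_isCoextremal [Infinite k]
    (hI : I.IsHomogeneous (homogeneousSubmodule (Fin d) k)) {i : Fin d} {j : ℕ}
    (h : IsCoextremal I i.rev j) : sreg I (i + 1) = (j : EReal) + 1 := by
  by_cases hbt : I = ⊥ ∨ I = ⊤
  · exact absurd (genericAnnihilatorNumber_eq_zero hI hbt _ _) h.1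
  rw [not_or] at hbt
  obtain ⟨m, h1, h2, t, ht, htm⟩ := exists_sreg_succ_eq hI hbt.1 hbt.2 i
  rw [isCoextremal_rev_iff] at h
  rw [h1, natCast_add_one_inj]
  refine le_antisymm (le_of_not_gt fun hlt => htm ?_) (le_of_not_gt fun hlt => h.1 ?_)
  · exact h.2 t ht m hlt.le fun heq => hlt.ne' (Prod.ext_iff.1 heq).2
  · exact h2 i le_rfl j hlt

/-- Because of the jump, the rows `t.rev` with t < i have no entry in degree j or above, so the
entry that attains the maximum lies in row `i.rev`. -/
lemma isCoextremal_of_sreg_lt [Infinite k]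
    (hI : I.IsHomogeneous (homogeneousSubmodule (Fin d) k)) {i : Fin d} {j : ℕ}
    (hlt : sreg I i < sreg I (i + 1)) (hj : sreg I (i + 1) = (j : EReal) + 1) :
    IsCoextremal I i.rev j := by
  by_cases hbt : I = ⊥ ∨ I = ⊤
  · exact absurd hlt (not_sreg_lt hI hbt i)
  rw [not_or] at hbt
  obtain ⟨m, h1, h2, t, ht, htm⟩ := exists_sreg_succ_eq hI hbt.1 hbt.2 i
  obtain ⟨m', h1', h2', -⟩ := exists_sreg_eq hI hbt.2 i.2.le (Or.inl hbt.1)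
  rw [h1, h1', natCast_add_one_lt_iff] at hlt
  obtain rfl : m = j := natCast_add_one_inj.1 (h1.symm.trans hj)
  obtain rfl : t = i := by
    refine le_antisymm ht (le_of_not_gt fun hti => htm (h2' t hti m hlt))
  refine (isCoextremal_rev_iff t m).2 ⟨htm, fun t' ht' j' hj' hne => ?_⟩
  rcases hj'.lt_or_eq with hj' | rfl
  · exact h2 t' ht' j' hj'
  · refine h2' t' (lt_of_le_of_ne ht' fun h => hne ?_) m hlt
    rw [Fin.ext h]

lemma sreg_succ_mono [Infinite k] (hI : I.IsHomogeneous (homogeneousSubmodule (Fin d) k))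
    (hIb : I ≠ ⊥) {i i' : Fin d} (hii : i ≤ i') : sreg I (i + 1) ≤ sreg I (i' + 1) := by
  by_cases hIt : I = ⊤
  · subst hIt
    rw [sreg_top (by omega), sreg_top (by omega)]
  obtain ⟨m, h1, -, t, ht, htm⟩ := exists_sreg_succ_eq hI hIb hIt i
  obtain ⟨m', h1', h2', -⟩ := exists_sreg_succ_eq hI hIb hIt i'
  rw [h1, h1']
  exact le_of_not_gt fun hlt => htm (h2' t (ht.trans hii) m (natCast_add_one_lt_iff.1 hlt))

/-- Among the rows `t.rev`, t ≤ i, that attain the last occupied degree, the one with the smallest t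
gives a coextremal entry. -/
lemma exists_isCoextremal [Infinite k] (hI : I.IsHomogeneous (homogeneousSubmodule (Fin d) k))
    (hIb : I ≠ ⊥) (hIt : I ≠ ⊤) (i : Fin d) :
    ∃ t ≤ i, ∃ j : ℕ, IsCoextremal I t.rev j ∧ sreg I (i + 1) = (j : EReal) + 1 := by
  obtain ⟨m, h1, h2, h3⟩ := exists_sreg_succ_eq hI hIb hIt i
  obtain ⟨t, ⟨ht, htm⟩, hmin⟩ := exists_minimal_of_wellFoundedLT
    (fun t : Fin d => t ≤ i ∧ genericAnnihilatorNumber I t.rev m ≠ 0) h3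
  refine ⟨t, ht, m, (isCoextremal_rev_iff t m).2 ⟨htm, fun t' ht' j' hj' hne => ?_⟩, h1⟩
  rcases hj'.lt_or_eq with hj' | rfl
  · exact h2 t' (ht'.trans ht) j' hj'
  · by_contra hcon
    exact hne (by rw [le_antisymm ht' (hmin ⟨ht'.trans ht, hcon⟩ ht')])

/-- For i = 0 the equivalence can fail: for the irrelevant ideal sreg_0 = sreg_1 = 1, yet α_{d-1,0}
is coextremal. For i > 0 the value sreg_i - 1 is attained in an earlier row, which coextremality
bounds. -/
lemma sreg_lt_iff [Infinite k] (hI : I.IsHomogeneous (homogeneousSubmodule (Fin d) k)) (i : Fin d)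
    (hi : 0 < (i : ℕ)) :
    sreg I i < sreg I (i + 1) ↔ ∃ j : ℕ, IsCoextremal I i.rev j := by
  by_cases hbt : I = ⊥ ∨ I = ⊤
  · exact iff_of_false (not_sreg_lt hI hbt i) fun ⟨j, hj⟩ =>
      hj.1 (genericAnnihilatorNumber_eq_zero hI hbt _ _)
  rw [not_or] at hbt
  constructor
  · intro h
    obtain ⟨m, h1, -⟩ := exists_sreg_succ_eq hI hbt.1 hbt.2 i
    exact ⟨m, isCoextremal_of_sreg_lt hI h h1⟩
  · rintro ⟨j, hj⟩
    obtain ⟨m, h1, -, t, ht, htm⟩ := exists_sreg_succ_eq hI hbt.1 hbt.2 ⟨i - 1, by omega⟩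
    rw [Fin.val_mk, Nat.sub_add_cancel hi] at h1
    rw [sreg_eq_of_isCoextremal hI hj, h1, natCast_add_one_lt_iff]
    have hti : t < i := by
      have : (t : ℕ) ≤ i - 1 := ht
      exact Fin.lt_def.2 (by omega)
    by_contra hlt
    exact htm (((isCoextremal_rev_iff i j).1 hj).2 t hti.le m (not_lt.1 hlt)
      fun heq => hti.ne (Prod.ext_iff.1 heq).1)

end

end SectionalRegularity

end

/-- Below `i : Fin d` stands for the index `i + 1` of `1, …, d`, so that `i.rev` is `d - (i + 1)`. -/
theorem mainTheorem4 {k : Type*} [Field k] [Infinite k] {d : ℕ}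
    (I : Ideal (MvPolynomial (Fin d) k))
    (hI : I.IsHomogeneous (MvPolynomial.homogeneousSubmodule (Fin d) k)) :
    -- the invariants are well defined, and computed by almost regular sequences
    (SectionalRegularity.ForGeneral fun g : GL (Fin d) k =>
      SectionalRegularity.IsAlmostRegular I g ∧
      (∀ i ≤ d, SectionalRegularity.idealRegularity (SectionalRegularity.sectionIdeal I g i) =
        SectionalRegularity.sreg I i) ∧
      (∀ (s : Fin d) (j : ℕ), SectionalRegularity.annihilatorNumber I g s j =
        SectionalRegularity.genericAnnihilatorNumber I s j)) ∧
    -- coextremal annihilator numbers give values of the sectional regularity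
    (∀ (i : Fin d) (j : ℕ), SectionalRegularity.IsCoextremal I i.rev j →
      SectionalRegularity.sreg I (i + 1) = (j : EReal) + 1) ∧
    -- jumps give coextremal annihilator numbers
    (∀ (i : Fin d) (j : ℕ),
      SectionalRegularity.sreg I i < SectionalRegularity.sreg I (i + 1) →
      SectionalRegularity.sreg I (i + 1) = (j : EReal) + 1 →
      SectionalRegularity.IsCoextremal I i.rev j) ∧
    -- the positions of the jumps in `sreg_1, …, sreg_d`
    (∀ i : Fin d, 0 < (i : ℕ) →
      (SectionalRegularity.sreg I i < SectionalRegularity.sreg I (i + 1) ↔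
        ∃ j : ℕ, SectionalRegularity.IsCoextremal I i.rev j)) ∧
    -- the sequence `sreg_1, …, sreg_d` is nondecreasing
    (I ≠ ⊥ → ∀ i i' : Fin d, i ≤ i' →
      SectionalRegularity.sreg I (i + 1) ≤ SectionalRegularity.sreg I (i' + 1)) ∧
    -- its values, and the whole sequence, in terms of the coextremal annihilator numbers
    (I ≠ ⊥ → I ≠ ⊤ →
      {r : EReal | ∃ i : Fin d, r = SectionalRegularity.sreg I (i + 1)} =
        {r : EReal | ∃ (s : Fin d) (j : ℕ),
          SectionalRegularity.IsCoextremal I s j ∧ r = (j : EReal) + 1} ∧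
      ∀ i : Fin d, IsGreatest
        {r : EReal | ∃ (s : Fin d) (j : ℕ), i.rev ≤ s ∧
          SectionalRegularity.IsCoextremal I s j ∧ r = (j : EReal) + 1}
        (SectionalRegularity.sreg I (i + 1))) := by
  open SectionalRegularity in
  refine ⟨?_, fun i j h => sreg_eq_of_isCoextremal hI h,
    fun i j hlt hj => isCoextremal_of_sreg_lt hI hlt hj, fun i hi => sreg_lt_iff hI i hi,
    fun hIb i i' hii => sreg_succ_mono hI hIb hii, fun hIb hIt => ⟨?_, fun i => ⟨?_, ?_⟩⟩⟩
  · obtain ⟨N, hgen⟩ := forGeneral_sections hI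
    refine hgen.mono fun g ⟨hg, hgr, hga, _⟩ => ⟨fun i => ?_, hgr, fun s j => by rw [hga]⟩
    exact finiteDimensional_annihilatorIn (isHomogeneous_sectionIdeal g hI _) (g i) (hg i)
  · ext r
    constructor
    · rintro ⟨i, rfl⟩
      obtain ⟨t, -, j, hj, hr⟩ := exists_isCoextremal hI hIb hIt i
      exact ⟨t.rev, j, hj, hr⟩
    · rintro ⟨s, j, hj, rfl⟩
      rw [← Fin.rev_rev s] at hj
      exact ⟨s.rev, (sreg_eq_of_isCoextremal hI hj).symm⟩
  · obtain ⟨t, ht, j, hj, hr⟩ := exists_isCoextremal hI hIb hIt i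
    exact ⟨t.rev, j, Fin.rev_le_rev.2 ht, hj, hr⟩
  · rintro _ ⟨s, j, hs, hj, rfl⟩
    rw [← Fin.rev_rev s] at hs hj
    rw [← sreg_eq_of_isCoextremal hI hj]
    exact sreg_succ_mono hI hIb (Fin.rev_le_rev.1 hs)
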